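/- Let $\mathcal M=\{3,3\}$ be the tetrahedral map. Let $\Delta=\Delta(3,\infty,3)=\langle x,y,z\mid x^3=z^3=xyz=1\rangle$, and let $M$ be the normal closure of $y^2$ in $\Delta$; this is the fundamental group of the sphere $S$ punctured at the six midpoints of the edges of $\mathcal M$. For a commutative ring $R$ let $H_1(S;R)=R\otimes_{\mathbb Z}M^{\rm ab}$, on which $G=\Delta/M$ acts by conjugation. A hypermap is a finite non-empty set of darts with permutations $x,y,z$, $xyz=1$, generating a transitive group; its vertices, edges and faces are the cycles of $x,y,z$, its type is the triple of orders of $x,y,z$, and its genus $g$ is given by $\#\text{vertices}+\#\text{edges}+\#\text{faces}-\#\text{darts}=2-2g$. It is orientably regular if its orientation-preserving automorphism group (the permutations commuting with $x,y,z$) is transitive on darts; an orientably regular hypermap is regular if it is isomorphic to its mirror image (in which $x,y$ are replaced by $x^{-1},y^{-1}$), and chiral otherwise. For a prime $p$, let $E^\dagger_p$ be the set of isomorphism classes of coverings $\mathcal N\to\mathcal M$, where $\mathcal N$ is an orientably regular hypermap, the covering is regular and unbranched over the vertices and faces of $\mathcal M$, and the covering group is an elementary abelian $p$-group of rank $c\ge1$.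 (a) $M$ is the kernel of the action of $\Delta$ on the darts of $\mathcal M$, $G\cong A_4$, $\dim H_1(S;\mathbb C)=5$, and $G$ has character $\chi_2+\chi_3+\chi_4$ on $H_1(S;\mathbb C)$, where, on the identity, the double transpositions, and the two classes of $3$-cycles respectively, $\chi_2=(1,1,\omega,\overline\omega)$, $\chi_3=(1,1,\overline\omega,\omega)$ and $\chi_4=(3,-1,0,0)$, with $\omega=e^{2\pi i/3}$. (b) For every prime $p$, each $\mathcal N\in E^\dagger_p$ of rank $c$ has type $(3,2p,3)$ and genus $2p^c-3p^{c-1}+1$. (c) If $p\equiv1$ mod $3$, then $H_1(S;\mathbb F_p)$ is a direct sum of three irreducible $G$-submodules of dimensions $1,1,3$, with characters $\chi_2,\chi_3,\chi_4$ reduced mod $p$ (so that $\omega$ becomes a primitive cube root of $1$ in $\mathbb F_p$, and $\overline\omega$ becomes $\omega^2$). The set $E^\dagger_p$ has exactly seven elements, with $c=1,1,2,3,4,4,5$, and their hypermaps are pairwise non-isomorphic. The two hypermaps with $c=1$ are chiral and are mirror images of each other, as are the two with $c=4$; the other three are regular. (d) If $2<p\equiv2$ mod $3$, then $H_1(S;\mathbb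 F_p)$ is a direct sum of two irreducible $G$-submodules of dimensions $2$ and $3$, with characters $\chi_2+\chi_3$ and $\chi_4$ reduced mod $p$. The set $E^\dagger_p$ has exactly three elements, with $c=2,3,5$; their hypermaps are pairwise non-isomorphic and all regular. -/

import Mathlib

open scoped TensorProduct

namespace PlatonicCoverings

/-! ### Oriented hypermaps

A finite oriented hypermap (on a compact connected oriented surface without boundary) is a finite
non-empty set of darts with three permutations `x`, `y`, `z` satisfying `x * y * z = 1` which
generate a transitive group. Its hypervertices, hyperedges and hyperfaces are the cycles of `x`,
`y` and `z`. A map is a hypermap with `y ^ 2 = 1`; its darts are the directed edges. -/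

structure Hypermap where
  Dart : Type
  finite : Finite Dart
  nonempty : Nonempty Dart
  x : Equiv.Perm Dart
  y : Equiv.Perm Dart
  connected : ∀ d d' : Dart, ∃ w ∈ Subgroup.closure {x, y}, w d = d'

namespace Hypermap

/-- The third permutation, determined by `x * y * z = 1`. -/
def z (H : Hypermap) : Equiv.Perm H.Dart := (H.x * H.y)⁻¹

/-- A hypermap is of type `(a, b, c)` if `x`, `y`, `z` have orders `a`, `b`, `c`. -/
def HasType (H : Hypermap) (a b c : ℕ) : Prop :=
  orderOf H.x = a ∧ orderOf H.y = b ∧ orderOf H.z = c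

/-- The number of cycles of a permutation, fixed points included. -/
noncomputable def numCycles {D : Type} (f : Equiv.Perm D) : ℕ :=
  Nat.card (Quotient (Equiv.Perm.SameCycle.setoid f))

/-- The underlying surface has genus `g`: its Euler characteristic
`#vertices + #edges + #faces - #darts` is `2 - 2 * g`. -/
def HasGenus (H : Hypermap) (g : ℤ) : Prop :=
  (numCycles H.x + numCycles H.y + numCycles H.z - Nat.card H.Dart : ℤ) = 2 - 2 * g

/-- The orientation-preserving automorphism group: the permutations of the darts
commuting with `x` and `y` (hence with `z`). -/
def autPlus (H : Hypermap) : Subgroup (Equiv.Perm H.Dart) :=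
  Subgroup.centralizer {H.x, H.y}

def IsOrientablyRegular (H : Hypermap) : Prop :=
  ∀ d d' : H.Dart, ∃ σ ∈ H.autPlus, σ d = d'

/-- The mirror image: the orientation of the surface is reversed. -/
def mirror (H : Hypermap) : Hypermap where
  Dart := H.Dart
  finite := H.finite
  nonempty := H.nonempty
  x := H.x⁻¹
  y := H.y⁻¹
  connected := by
    intro d d'
    obtain ⟨w, hw, h⟩ := H.connected d d'
    refine ⟨w, ?_, h⟩
    have hle : Subgroup.closure {H.x, H.y} ≤ Subgroup.closure {H.x⁻¹, H.y⁻¹} := by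
      rw [Subgroup.closure_le]
      rintro u (rfl | rfl)
      · exact inv_mem_iff.mp (Subgroup.subset_closure (by simp))
      · exact inv_mem_iff.mp (Subgroup.subset_closure (by simp))
    exact hle hw

/-- A covering of hypermaps, possibly branched over vertices, edges and faces. -/
structure Covering (H K : Hypermap) where
  toFun : H.Dart → K.Dart
  map_x : ∀ d, toFun (H.x d) = K.x (toFun d)
  map_y : ∀ d, toFun (H.y d) = K.y (toFun d)

/-- An (orientation-preserving) isomorphism of hypermaps. -/
structure Iso (H K : Hypermap) extends H.Dart ≃ K.Dart where
  map_x : ∀ d, toFun (H.x d) = K.x (toFun d)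
  map_y : ∀ d, toFun (H.y d) = K.y (toFun d)

/-- An orientably regular hypermap is *regular* (reflexible) if it is isomorphic to its mirror
image, and *chiral* otherwise. -/
def IsReflexible (H : Hypermap) : Prop := Nonempty (Iso H H.mirror)

namespace Covering

variable {H K : Hypermap}

/-- The group of covering transformations. -/
def deckGroup (φ : Covering H K) : Subgroup (Equiv.Perm H.Dart) where
  carrier := {σ | σ ∈ H.autPlus ∧ ∀ d, φ.toFun (σ d) = φ.toFun d}
  one_mem' := ⟨one_mem _, fun _ => rfl⟩
  mul_mem' := by
    rintro σ τ ⟨h1, h2⟩ ⟨h3, h4⟩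
    exact ⟨mul_mem h1 h3, fun d => by rw [Equiv.Perm.mul_apply, h2, h4]⟩
  inv_mem' := by
    rintro σ ⟨h1, h2⟩
    refine ⟨inv_mem h1, fun d => ?_⟩
    rw [← h2 (σ⁻¹ d), ← Equiv.Perm.mul_apply, mul_inv_cancel, Equiv.Perm.one_apply]

/-- The covering is regular: the covering transformations are transitive on each fibre. -/
def IsRegular (φ : Covering H K) : Prop :=
  ∀ d d' : H.Dart, φ.toFun d = φ.toFun d' → ∃ σ ∈ φ.deckGroup, σ d = d'

/-- The covering is unbranched except possibly over the (hyper)edges: a vertex (face) of `H` has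
the same valency as the vertex (face) of `K` below it. -/
def IsBranchedOnlyOverEdges (φ : Covering H K) : Prop :=
  ∀ d, Function.minimalPeriod H.x d = Function.minimalPeriod K.x (φ.toFun d) ∧
    Function.minimalPeriod H.z d = Function.minimalPeriod K.z (φ.toFun d)

/-- `φ` is an orientably regular covering of `K`, branched over the edges, whose covering group is
an elementary abelian `p`-group of rank `c ≥ 1`. -/
def IsElementaryAbelian (φ : Covering H K) (p c : ℕ) : Prop :=
  1 ≤ c ∧ H.IsOrientablyRegular ∧ φ.IsRegular ∧ φ.IsBranchedOnlyOverEdges ∧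
    (∀ σ ∈ φ.deckGroup, ∀ τ ∈ φ.deckGroup, σ * τ = τ * σ) ∧
    (∀ σ ∈ φ.deckGroup, σ ^ p = 1) ∧
    Nat.card φ.deckGroup = p ^ c

end Covering

/-- The hypermaps `N i` with their projections `φ i` form, without repetition, a complete list of
the elementary abelian `p`-coverings of `K` branched over edges, `φ i` having rank `c i`. No two of
the `N i` are isomorphic, even as hypermaps; every such covering of `K` is isomorphic to
some `φ i` as a covering of `K`. -/
def IsCompleteList (K : Hypermap) (p : ℕ) {n : ℕ} (c : Fin n → ℕ) (N : Fin n → Hypermap)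
    (φ : ∀ i, Covering (N i) K) : Prop :=
  (∀ i, (φ i).IsElementaryAbelian p (c i)) ∧
  (∀ i j, Nonempty (Iso (N i) (N j)) → i = j) ∧
  (∀ (H : Hypermap) (ψ : Covering H K) (r : ℕ), ψ.IsElementaryAbelian p r →
    ∃ (i : Fin n) (f : Iso H (N i)), ∀ d, (φ i).toFun (f.toFun d) = ψ.toFun d)

end Hypermap

/-! ### The tetrahedron -/

/-- A directed edge of the tetrahedron: from the vertex `d.1` to the vertex `d.2`. -/
abbrev TetDart : Type := {d : Fin 4 × Fin 4 // d.1 ≠ d.2}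

/-- The cyclic order in which the orientation arranges the neighbours of a vertex. -/
def tetRotation : Fin 4 → Equiv.Perm (Fin 4)
  | 0 => c[1, 2, 3]
  | 1 => c[0, 3, 2]
  | 2 => c[0, 1, 3]
  | 3 => c[0, 2, 1]

lemma tetRotation_self (v : Fin 4) : tetRotation v v = v := by
  revert v; decide

/-- Rotation of a directed edge around its initial vertex. -/
def tetX : Equiv.Perm TetDart where
  toFun d := ⟨(d.1.1, tetRotation d.1.1 d.1.2), fun h => d.2
    ((tetRotation d.1.1).injective ((tetRotation_self d.1.1).trans h))⟩
  invFun d := ⟨(d.1.1, (tetRotation d.1.1)⁻¹ d.1.2), fun h => d.2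
    ((tetRotation_self d.1.1).symm.trans ((Equiv.Perm.eq_inv_iff_eq.mp h)))⟩
  left_inv d := by ext <;> simp
  right_inv d := by ext <;> simp

/-- Reversal of a directed edge. -/
def tetY : Equiv.Perm TetDart where
  toFun d := ⟨(d.1.2, d.1.1), d.2.symm⟩
  invFun d := ⟨(d.1.2, d.1.1), d.2.symm⟩
  left_inv _ := rfl
  right_inv _ := rfl

lemma tet_connected_aux : ∀ d d' : TetDart, ∃ i j k : Fin 3,
    (tetX ^ (i : ℕ) * tetY * tetX ^ (j : ℕ) * tetY * tetX ^ (k : ℕ)) d = d' := by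
  decide

/-- The tetrahedral map `{3, 3}`. -/
def tetrahedron : Hypermap where
  Dart := TetDart
  finite := inferInstance
  nonempty := ⟨⟨(0, 1), by decide⟩⟩
  x := tetX
  y := tetY
  connected := by
    intro d d'
    obtain ⟨i, j, k, h⟩ := tet_connected_aux d d'
    have hx : tetX ∈ Subgroup.closure {tetX, tetY} := Subgroup.subset_closure (by simp)
    have hy : tetY ∈ Subgroup.closure {tetX, tetY} := Subgroup.subset_closure (by simp)
    exact ⟨_, mul_mem (mul_mem (mul_mem (mul_mem (pow_mem hx _) hy) (pow_mem hx _)) hy)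
      (pow_mem hx _), h⟩

/-! ### Triangle groups and homology of the punctured sphere -/

def triangleRels (a b c : ℕ) : Set (FreeGroup (Fin 3)) :=
  {FreeGroup.of 0 ^ a, FreeGroup.of 1 ^ b, FreeGroup.of 2 ^ c,
    FreeGroup.of 0 * FreeGroup.of 1 * FreeGroup.of 2}

/-- The triangle group `⟨x, y, z | x ^ a = y ^ b = z ^ c = x * y * z = 1⟩`. A relation `g ^ ∞ = 1`,
which is to be ignored, is written `g ^ 0 = 1`. -/
abbrev TriangleGroup (a b c : ℕ) : Type := PresentedGroup (triangleRels a b c)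

/-- The triangle group `Δ(3, ∞, 3)`. The hypermaps with `x ^ 3 = z ^ 3 = 1` correspond to the
conjugacy classes of its (finite index) subgroups. -/
abbrev EdgeTriangleGroup : Type := TriangleGroup 3 0 3

/-- The normal closure `M` of `y ^ 2` in `Δ(3, ∞, 3)`, the subgroup which corresponds to the
tetrahedron. It is the fundamental group of the sphere punctured at the six midpoints of the
edges of the tetrahedron. -/
def edgePuncturedPi : Subgroup EdgeTriangleGroup :=
  Subgroup.normalClosure {(PresentedGroup.of 1) ^ 2}

instance : edgePuncturedPi.Normal := Subgroup.normalClosure_normal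

/-- The orientation-preserving automorphism group `G = Δ(3, ∞, 3) / M` of the tetrahedron. -/
abbrev TetGroup : Type := EdgeTriangleGroup ⧸ edgePuncturedPi

/-- The action of `Δ(3, ∞, 3)` on the darts of the tetrahedron. -/
def tetMonodromy : EdgeTriangleGroup →* Equiv.Perm tetrahedron.Dart :=
  PresentedGroup.toGroup (f := ![tetrahedron.x, tetrahedron.y, tetrahedron.z]) (by
    have h1 : tetX ^ 3 = 1 := by decide
    have h2 : ((tetX * tetY)⁻¹) ^ 3 = 1 := by decide
    rintro r (rfl | rfl | rfl | rfl)
    · simpa using! h1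
    · simp
    · simpa using! h2
    · simp [Hypermap.z])

/-- The first integral homology group of the punctured sphere: the abelianisation of its
fundamental group, written additively. -/
abbrev HomologyInt : Type := Additive (Abelianization edgePuncturedPi)

/-- The action of `Δ(3, ∞, 3)` on integral homology which is induced by conjugation. -/
noncomputable def conjHomology : EdgeTriangleGroup →* Module.End ℤ HomologyInt where
  toFun g := (MonoidHom.toAdditive
    (Abelianization.map (MulAut.conjNormal (H := edgePuncturedPi) g).toMonoidHom)).toIntLinearMap
  map_one' := by
    ext m
    induction m using Additive.rec with | _ m =>
    induction m using QuotientGroup.induction_on with | _ m =>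
    exact congrArg (fun t => Additive.ofMul (Abelianization.of t)) (by ext; simp)
  map_mul' g h := by
    ext m
    induction m using Additive.rec with | _ m =>
    induction m using QuotientGroup.induction_on with | _ m =>
    exact congrArg (fun t => Additive.ofMul (Abelianization.of t)) (by ext; simp)

lemma conjHomology_eq_one (g : EdgeTriangleGroup) (hg : g ∈ edgePuncturedPi) :
    conjHomology g = 1 := by
  ext m
  induction m using Additive.rec with | _ m =>
  induction m using QuotientGroup.induction_on with | _ m =>
  change Additive.ofMul (Abelianization.of (MulAut.conjNormal (H := edgePuncturedPi) g m)) =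
    Additive.ofMul (Abelianization.of m)
  have h : MulAut.conjNormal (H := edgePuncturedPi) g m =
      (⟨g, hg⟩ : edgePuncturedPi) * m * (⟨g, hg⟩ : edgePuncturedPi)⁻¹ := by
    ext; simp
  refine congrArg Additive.ofMul ?_
  rw [h, map_mul, map_mul, map_inv, mul_right_comm, mul_inv_cancel, one_mul]

/-- The first homology group of the punctured sphere with coefficients in `R`. -/
abbrev Homology (R : Type) [CommRing R] : Type := R ⊗[ℤ] HomologyInt

/-- The representation of `G` on the first homology group of the punctured sphere. -/
noncomputable def homologyRep (R : Type) [CommRing R] : Representation R TetGroup (Homology R) :=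
  QuotientGroup.lift edgePuncturedPi
    ((Module.End.baseChangeHom ℤ R HomologyInt : _ →* _).comp conjHomology) (by
      intro g hg
      rw [MonoidHom.mem_ker, MonoidHom.comp_apply, conjHomology_eq_one g hg, map_one])

/-! ### The character table of `A₄`

The entries are taken in a commutative ring with a given cube root of unity `ω`. The classes are
the identity, the double transpositions, the conjugates of the three-cycle `(0 1 2)`, and the
inverses of these. -/

abbrev A4 : Type := alternatingGroup (Fin 4)

def threeCycle : A4 := ⟨c[0, 1, 2], by rw [Equiv.Perm.mem_alternatingGroup]; decide⟩

def chi2 {R : Type} [CommRing R] (ω : R) (g : A4) : R :=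
  if g ^ 2 = 1 then 1 else if IsConj threeCycle g then ω else ω ^ 2

def chi3 {R : Type} [CommRing R] (ω : R) (g : A4) : R :=
  if g ^ 2 = 1 then 1 else if IsConj threeCycle g then ω ^ 2 else ω

def chi4 (R : Type) [CommRing R] (g : A4) : R :=
  if g = 1 then 3 else if g ^ 2 = 1 then -1 else 0

end PlatonicCoverings

namespace PlatonicCoverings

/-! ### The group `Δ(3, ∞, 3)` -/

/-! The coverings in question are unbranched over vertices and faces, so their hypermaps satisfy `x
^ 3 = z ^ 3 = 1` and carry an action of Δ = Δ(3, ∞, 3). In an orientably regular hypermap a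
monodromy element which fixes one dart is trivial, so the hypermap is Δ/N for the monodromy kernel
N, and N is an isomorphism invariant. A covering of the tetrahedron forces N ≤ M, and its covering
group is M/N up to passing to the opposite group (`exists_deckHom`). When this group is elementary
abelian of rank c, N is the preimage of a G-stable subspace W of H₁(S; F_p) of codimension c;
conversely each proper stable W gives a covering (`exists_subrep_of_isElementaryAbelian`,
`subrepCovering_isElementaryAbelian`). Everything but the type and the genus is thus read off from
the submodules of the homology.

The homology is computed without topology. The conjugates of the loop y² span it; up to homology
there are six of them, with one relation (`sum_loops`), so the dimension is at most 5. For the lower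
bound, Δ is made to act on F⁵ by affine maps whose linear parts factor through G. On M the action is
by translations, and these define a G-equivariant map from the homology to F⁵ which is onto when 2
is invertible and the translation of y is suitably chosen (`exists_coordinates`).

In these coordinates F⁵ is a plane, on which y is trivial and x satisfies 1 + x + x² = 0, plus a
three-dimensional monomial module with character χ₄. If F has a primitive cube root of unity the
plane splits into two lines with different characters; if `r ^ 2 + r + 1` has no root it is
irreducible. The blocks are irreducible and pairwise non-isomorphic, so every stable subspace is a
sum of blocks: 2³ − 1 = 7 or 2² − 1 = 3 proper ones.

Reflection is the automorphism of Δ inverting x and y. It acts on the stable subspaces preserving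
dimension, so a subspace determined by its dimension gives a regular hypermap. Since it sends x to
x⁻¹ it exchanges the two eigenlines, which produces the chiral pairs. For the genus, Δ/N acts freely
on its 12·p^c darts, so the cycle numbers follow from the orders 3, 2p, 3 of x, y, z. -/

/-- The generator `x` of `Δ(3, ∞, 3)`. -/
def gx : EdgeTriangleGroup := PresentedGroup.of 0

/-- The generator `y` of `Δ(3, ∞, 3)`. -/
def gy : EdgeTriangleGroup := PresentedGroup.of 1

/-- The generator `z` of `Δ(3, ∞, 3)`. -/
def gz : EdgeTriangleGroup := PresentedGroup.of 2

lemma gx_pow_three : gx ^ 3 = 1 :=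
  PresentedGroup.one_of_mem (rels := triangleRels 3 0 3) (x := FreeGroup.of 0 ^ 3)
    (by simp [triangleRels])

lemma gz_pow_three : gz ^ 3 = 1 :=
  PresentedGroup.one_of_mem (rels := triangleRels 3 0 3) (x := FreeGroup.of 2 ^ 3)
    (by simp [triangleRels])

lemma gx_mul_gy_mul_gz : gx * gy * gz = 1 :=
  PresentedGroup.one_of_mem (rels := triangleRels 3 0 3)
    (x := FreeGroup.of 0 * FreeGroup.of 1 * FreeGroup.of 2) (by simp [triangleRels])

lemma gz_eq : gz = (gx * gy)⁻¹ := eq_inv_of_mul_eq_one_right gx_mul_gy_mul_gz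

lemma gx_mul_gy_pow_three : (gx * gy) ^ 3 = 1 := by
  have := gz_pow_three
  rwa [gz_eq, inv_pow, inv_eq_one] at this

lemma closure_gx_gy : Subgroup.closure {gx, gy} = ⊤ := by
  rw [eq_top_iff, ← PresentedGroup.closure_range_of (triangleRels 3 0 3), Subgroup.closure_le]
  have hx : gx ∈ Subgroup.closure {gx, gy} := Subgroup.subset_closure (by simp)
  have hy : gy ∈ Subgroup.closure {gx, gy} := Subgroup.subset_closure (by simp)
  rintro _ ⟨i, rfl⟩
  fin_cases i
  · exact hx
  · exact hy
  · change gz ∈ _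
    rw [gz_eq]
    exact inv_mem (mul_mem hx hy)

/-- The universal property of `Δ(3, ∞, 3)`, in terms of `x` and `y`. -/
def deltaLift {L : Type*} [Group L] (a b : L) (ha : a ^ 3 = 1) (hab : (a * b) ^ 3 = 1) :
    EdgeTriangleGroup →* L :=
  PresentedGroup.toGroup (f := ![a, b, (a * b)⁻¹]) (by
    have h : ((a * b)⁻¹) ^ 3 = 1 := by rw [inv_pow, hab, inv_one]
    rintro r (rfl | rfl | rfl | rfl)
    · simpa using ha
    · simp
    · simpa using! h
    · simp)

section deltaLift

variable {L : Type*} [Group L] (a b : L) (ha : a ^ 3 = 1) (hab : (a * b) ^ 3 = 1)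

@[simp] lemma deltaLift_gx : deltaLift a b ha hab gx = a := PresentedGroup.toGroup.of _

@[simp] lemma deltaLift_gy : deltaLift a b ha hab gy = b := PresentedGroup.toGroup.of _

end deltaLift

lemma delta_hom_ext {L : Type*} [Monoid L] {f g : EdgeTriangleGroup →* L} (hx : f gx = g gx)
    (hy : f gy = g gy) : f = g := by
  refine MonoidHom.eq_of_eqOn_dense closure_gx_gy ?_
  rintro _ (rfl | rfl)
  · exact hx
  · exact hy

lemma gy_sq_mem : gy ^ 2 ∈ edgePuncturedPi := Subgroup.subset_normalClosure rfl

/-- The loop `y ^ 2` around a puncture. -/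
def loop : edgePuncturedPi := ⟨gy ^ 2, gy_sq_mem⟩

lemma tetGroup_mk_eq_one {g : EdgeTriangleGroup} :
    (g : TetGroup) = 1 ↔ g ∈ edgePuncturedPi := QuotientGroup.eq_one_iff g

lemma tetGroup_gy_sq : (gy : TetGroup) ^ 2 = 1 := by
  rw [← QuotientGroup.mk_pow, tetGroup_mk_eq_one]
  exact gy_sq_mem

lemma tetGroup_gx_pow_three : (gx : TetGroup) ^ 3 = 1 := by
  rw [← QuotientGroup.mk_pow, gx_pow_three]; rfl

lemma tetGroup_gx_mul_gy_pow_three : ((gx : TetGroup) * gy) ^ 3 = 1 := by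
  rw [← QuotientGroup.mk_mul, ← QuotientGroup.mk_pow, gx_mul_gy_pow_three]; rfl

/-- The twelve elements `x ^ i` and `x ^ i * y * x ^ j` exhaust a group generated by `x` and `y`
with `x ^ 3 = y ^ 2 = (x * y) ^ 3 = 1`. -/
lemma normalForm_mul_left {L : Type*} [Group L] {a b : L} (ha : a ^ 3 = 1) (hb : b ^ 2 = 1)
    (hab : (a * b) ^ 3 = 1) {g : L}
    (hg : (∃ i : Fin 3, g = a ^ (i : ℕ)) ∨ ∃ i j : Fin 3, g = a ^ (i : ℕ) * b * a ^ (j : ℕ)) :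
    ((∃ i : Fin 3, a * g = a ^ (i : ℕ)) ∨
      ∃ i j : Fin 3, a * g = a ^ (i : ℕ) * b * a ^ (j : ℕ)) ∧
    ((∃ i : Fin 3, b * g = a ^ (i : ℕ)) ∨
      ∃ i j : Fin 3, b * g = a ^ (i : ℕ) * b * a ^ (j : ℕ)) := by
  have key : ∀ n : ℕ, ∃ i : Fin 3, a ^ n = a ^ (i : ℕ) := fun n =>
    ⟨⟨n % 3, Nat.mod_lt n (by norm_num)⟩, pow_eq_pow_mod n ha⟩
  have hbb : b * b = 1 := by rw [← sq, hb]
  -- This is the relation `(a * b) ^ 3 = 1` solved for `b * a * b`; `h2` below is its inverse.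
  -- Together they shorten any word in which two letters `b` are separated by a power of `a`.
  have h1 : b * a * b = a ^ 2 * b * a ^ 2 := by
    have h : a * (b * a * b) * (a * b) = 1 := by simpa [pow_succ, mul_assoc] using hab
    have h2 : a ^ 2 * a = 1 := by rw [← pow_succ, ha]
    have h3 : b * a * b = a⁻¹ * (a * b)⁻¹ := by
      rw [eq_mul_inv_iff_mul_eq, eq_inv_iff_mul_eq_one]
      calc b * a * b * (a * b) * a = a⁻¹ * (a * (b * a * b) * (a * b)) * a := by group
        _ = 1 := by rw [h, mul_one, inv_mul_cancel]
    rw [h3, mul_inv_rev, ← eq_inv_of_mul_eq_one_left hbb, ← eq_inv_of_mul_eq_one_left h2,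
      mul_assoc]
  have h2 : b * a ^ 2 * b = a * b * a := by
    have h := congrArg (fun t => t⁻¹) h1
    have h3 : a ^ 2 * a = 1 := by rw [← pow_succ, ha]
    have h4 : (a ^ 2)⁻¹ = a := (eq_inv_of_mul_eq_one_right h3).symm
    have h5 : b⁻¹ = b := (eq_inv_of_mul_eq_one_left hbb).symm
    have h6 : a⁻¹ = a ^ 2 := (eq_inv_of_mul_eq_one_left h3).symm
    simpa only [mul_inv_rev, h4, h5, h6, mul_assoc] using h
  rcases hg with ⟨i, rfl⟩ | ⟨i, j, rfl⟩
  · obtain ⟨k, hk⟩ := key (i + 1)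
    exact ⟨.inl ⟨k, by rw [← pow_succ', hk]⟩, .inr ⟨0, i, by simp⟩⟩
  · obtain ⟨k, hk⟩ := key (i + 1)
    refine ⟨.inr ⟨k, j, by rw [← mul_assoc, ← mul_assoc, ← pow_succ', hk]⟩, ?_⟩
    fin_cases i
    · exact .inl ⟨j, by simp [← mul_assoc, hbb]⟩
    · obtain ⟨l, hl⟩ := key (2 + j)
      exact .inr ⟨2, l, by rw [← hl, pow_add]; simp [← mul_assoc, h1]⟩
    · obtain ⟨l, hl⟩ := key (1 + j)
      exact .inr ⟨1, l, by rw [← hl, pow_add]; simp [← mul_assoc, h2]⟩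

/-- The twelve words include 1 and are permuted among themselves by left multiplication by x and y.
This bounds the order of G by 12, which is all that is needed to recognise kernels. -/
lemma tetGroup_normalForm (g : TetGroup) :
    (∃ i : Fin 3, g = (gx : TetGroup) ^ (i : ℕ)) ∨
      ∃ i j : Fin 3, g = (gx : TetGroup) ^ (i : ℕ) * gy * (gx : TetGroup) ^ (j : ℕ) := by
  obtain ⟨g, rfl⟩ := QuotientGroup.mk_surjective g
  have hg : g ∈ Subgroup.closure {gx, gy} := by rw [closure_gx_gy]; trivial
  have step := fun (h : TetGroup) => normalForm_mul_left (g := h) tetGroup_gx_pow_three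
    tetGroup_gy_sq tetGroup_gx_mul_gy_pow_three
  induction hg using Subgroup.closure_induction_left with
  | one => exact .inl ⟨0, by simp⟩
  | mul_left a ha b _ ih =>
    rcases ha with rfl | rfl
    · exact (step _ ih).1
    · exact (step _ ih).2
  | inv_mul_cancel a ha b _ ih =>
    rcases ha with rfl | rfl
    · have h := (step _ (step _ ih).1).1
      have h2 : ((gx⁻¹ * b : EdgeTriangleGroup) : TetGroup) =
          (gx : TetGroup) * ((gx : TetGroup) * b) := by
        rw [QuotientGroup.mk_mul, QuotientGroup.mk_inv, inv_mul_eq_iff_eq_mul, ← mul_assoc,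
          ← mul_assoc, ← pow_three', tetGroup_gx_pow_three, one_mul]
      rwa [h2]
    · have h2 : ((gy⁻¹ * b : EdgeTriangleGroup) : TetGroup) = (gy : TetGroup) * b := by
        rw [QuotientGroup.mk_mul, QuotientGroup.mk_inv, inv_mul_eq_iff_eq_mul, ← mul_assoc,
          ← sq, tetGroup_gy_sq, one_mul]
      rw [h2]
      exact (step _ ih).2

lemma edgePuncturedPi_le_ker {L : Type*} [Group L] (f : EdgeTriangleGroup →* L)
    (hy : f gy ^ 2 = 1) : edgePuncturedPi ≤ f.ker := by
  refine Subgroup.normalClosure_le_normal ?_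
  rintro _ rfl
  exact (map_pow f gy 2).trans hy

/-- Every element is congruent modulo M to one of the twelve normal forms, so a homomorphism killing
y² has kernel exactly M once no normal form other than 1 dies. The criterion is then a finite check.
-/
lemma ker_eq_edgePuncturedPi {L : Type*} [Group L] (f : EdgeTriangleGroup →* L)
    (hy : f gy ^ 2 = 1) (h1 : ∀ i : Fin 3, f gx ^ (i : ℕ) = 1 → i = 0)
    (h2 : ∀ i j : Fin 3, f gx ^ (i : ℕ) * f gy * f gx ^ (j : ℕ) ≠ 1) :
    f.ker = edgePuncturedPi := by
  refine le_antisymm (fun g hg => ?_) (edgePuncturedPi_le_ker f hy)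
  rw [MonoidHom.mem_ker] at hg
  have hM := edgePuncturedPi_le_ker f hy
  have hf : ∀ h : EdgeTriangleGroup, (g : TetGroup) = h → f h = 1 := fun h hgh => by
    have := hM (QuotientGroup.eq.mp hgh)
    rw [MonoidHom.mem_ker, map_mul, map_inv, hg] at this
    simpa using this
  rcases tetGroup_normalForm g with ⟨i, hi⟩ | ⟨i, j, hij⟩
  · have := h1 i (by rw [← map_pow]; exact hf _ hi)
    subst this
    rw [← tetGroup_mk_eq_one, hi]; simp
  · exact absurd (by simpa using hf (gx ^ (i : ℕ) * gy * gx ^ (j : ℕ)) hij) (h2 i j)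

@[simp] lemma tetMonodromy_gx : tetMonodromy gx = tetX := PresentedGroup.toGroup.of _

@[simp] lemma tetMonodromy_gy : tetMonodromy gy = tetY := PresentedGroup.toGroup.of _

lemma ker_tetMonodromy : tetMonodromy.ker = edgePuncturedPi := by
  apply ker_eq_edgePuncturedPi
  · rw [tetMonodromy_gy]; exact (by decide : tetY ^ 2 = 1)
  · rw [tetMonodromy_gx]; exact (by decide : ∀ i : Fin 3, tetX ^ (i : ℕ) = 1 → i = 0)
  · rw [tetMonodromy_gx, tetMonodromy_gy]
    exact (by decide : ∀ i j : Fin 3, tetX ^ (i : ℕ) * tetY * tetX ^ (j : ℕ) ≠ 1)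

/-- A double transposition. -/
def doubleTransposition : A4 :=
  ⟨c[0, 1] * c[2, 3], by rw [Equiv.Perm.mem_alternatingGroup]; decide⟩

/-- The epimorphism from `Δ(3, ∞, 3)` to `A₄`. -/
def toA4 : EdgeTriangleGroup →* A4 :=
  deltaLift threeCycle doubleTransposition (by decide) (by decide)

lemma ker_toA4 : toA4.ker = edgePuncturedPi := by
  apply ker_eq_edgePuncturedPi <;> simp only [toA4, deltaLift_gx, deltaLift_gy] <;> decide

lemma toA4_surjective : Function.Surjective toA4 := by
  have h : ∀ a : A4, (∃ i : Fin 3, threeCycle ^ (i : ℕ) = a) ∨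
      ∃ i j : Fin 3, threeCycle ^ (i : ℕ) * doubleTransposition * threeCycle ^ (j : ℕ) = a := by
    decide
  intro a
  rcases h a with ⟨i, rfl⟩ | ⟨i, j, rfl⟩
  · exact ⟨gx ^ (i : ℕ), by simp [toA4]⟩
  · exact ⟨gx ^ (i : ℕ) * gy * gx ^ (j : ℕ), by simp [toA4]⟩

/-- The group of the tetrahedron is `A₄`. -/
noncomputable def tetGroupEquiv : TetGroup ≃* A4 :=
  (QuotientGroup.quotientMulEquivOfEq ker_toA4.symm).trans
    (QuotientGroup.quotientKerEquivOfSurjective _ toA4_surjective)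

lemma tetGroupEquiv_mk (g : EdgeTriangleGroup) : tetGroupEquiv g = toA4 g := rfl

lemma index_edgePuncturedPi : edgePuncturedPi.index = 12 := by
  rw [Subgroup.index, Nat.card_congr tetGroupEquiv.toEquiv, Nat.card_eq_fintype_card]
  decide

/-- The product of suitable loops around the six punctures is trivial. -/
lemma prod_loops {L : Type*} [Group L] {a c u : L} (ha : a ^ 3 = 1) (hc : c ^ 3 = 1)
    (hu : u = (a⁻¹ * c⁻¹) ^ 2) :
    u * (c * u * c⁻¹) * (c ^ 2 * u * (c ^ 2)⁻¹) * (a * c * u * (a * c)⁻¹) *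
      (a ^ 2 * u * (a ^ 2)⁻¹) * (a ^ 2 * c * u * (a ^ 2 * c)⁻¹) = 1 := by
  have ha' : a⁻¹ = a * a := by
    rw [inv_eq_iff_mul_eq_one, ← pow_three, ha]
  have hc' : c⁻¹ = c * c := by
    rw [inv_eq_iff_mul_eq_one, ← pow_three, hc]
  have ha1 : a * (a * a) = 1 := by rw [← pow_three, ha]
  have hc1 : c * (c * c) = 1 := by rw [← pow_three, hc]
  have ha2 : ∀ t, a * (a * (a * t)) = t := fun t => by
    rw [← mul_assoc a a t, ← mul_assoc, ha1, one_mul]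
  have hc2 : ∀ t, c * (c * (c * t)) = t := fun t => by
    rw [← mul_assoc c c t, ← mul_assoc, hc1, one_mul]
  subst hu
  -- With inverses rewritten as squares, the product is a positive word in `a` and `c` which
  -- collapses by cancelling cubes. The hypothesis on `u` reflects `y = x⁻¹ * z⁻¹`, that is, `x * y
  -- * z = 1`.
  simp only [mul_inv_rev, ha', hc', sq, mul_assoc, ha1, hc1, ha2, hc2, mul_one]

/-! ### Homology classes of loops -/

section HomologyClass

variable (R : Type) [CommRing R]

/-- The class in `H₁(S; R)` of a loop. -/
noncomputable def homologyClass (m : edgePuncturedPi) : Homology R :=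
  1 ⊗ₜ[ℤ] Additive.ofMul (Abelianization.of m)

@[simp] lemma homologyClass_mul (m n : edgePuncturedPi) :
    homologyClass R (m * n) = homologyClass R m + homologyClass R n := by
  rw [homologyClass, map_mul, ofMul_mul, TensorProduct.tmul_add]; rfl

@[simp] lemma homologyClass_one : homologyClass R 1 = 0 := by
  rw [homologyClass, map_one, ofMul_one, TensorProduct.tmul_zero]

@[simp] lemma homologyClass_inv (m : edgePuncturedPi) :
    homologyClass R m⁻¹ = -homologyClass R m := by
  rw [homologyClass, map_inv, ofMul_inv, TensorProduct.tmul_neg]; rfl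

lemma homologyRep_homologyClass (g : EdgeTriangleGroup) (m : edgePuncturedPi) :
    homologyRep R (g : TetGroup) (homologyClass R m) =
      homologyClass R (MulAut.conjNormal g m) := by
  rfl

lemma span_range_homologyClass : Submodule.span R (Set.range (homologyClass R)) = ⊤ := by
  rw [eq_top_iff]
  rintro h -
  induction h using TensorProduct.induction_on with
  | zero => exact zero_mem _
  | add a b ha hb => exact add_mem ha hb
  | tmul r m =>
    induction m using Additive.rec with | _ m =>
    induction m using QuotientGroup.induction_on with | _ m =>
    rw [← mul_one r, ← smul_eq_mul, ← TensorProduct.smul_tmul']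
    exact Submodule.smul_mem _ _ (Submodule.subset_span ⟨m, rfl⟩)

variable {R}

lemma homology_hom_ext {V : Type*} [AddCommGroup V] [Module R V] {f g : Homology R →ₗ[R] V}
    (h : ∀ m, f (homologyClass R m) = g (homologyClass R m)) : f = g := by
  refine LinearMap.ext_on (span_range_homologyClass R) ?_
  rintro _ ⟨m, rfl⟩
  exact h m

variable (R)

/-- The homology of the punctured sphere is spanned by the loops around the punctures. -/
lemma span_range_homologyRep_loop :
    Submodule.span R (Set.range fun g => homologyRep R g (homologyClass R loop)) = ⊤ := by
  rw [eq_top_iff, ← span_range_homologyClass, Submodule.span_le]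
  rintro _ ⟨⟨m, hm⟩, rfl⟩
  have key : ∀ m ∈ edgePuncturedPi, ∃ hm : m ∈ edgePuncturedPi, homologyClass R ⟨m, hm⟩ ∈
      Submodule.span R (Set.range fun g => homologyRep R g (homologyClass R loop)) := by
    intro m hm
    have hm' : m ∈ Subgroup.closure (Group.conjugatesOfSet {gy ^ 2}) := hm
    induction hm' using Subgroup.closure_induction with
    | mem m h =>
      refine ⟨hm, Submodule.subset_span ?_⟩
      obtain ⟨a, rfl, h⟩ := Group.mem_conjugatesOfSet_iff.mp h
      obtain ⟨g, rfl⟩ := isConj_iff.mp h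
      exact ⟨g, (homologyRep_homologyClass R g loop).trans (congrArg _ (Subtype.ext rfl))⟩
    | one => exact ⟨one_mem _, by
        rw [show (⟨1, hm⟩ : edgePuncturedPi) = 1 from rfl, homologyClass_one]
        exact zero_mem _⟩
    | mul a b ha hb iha ihb =>
      obtain ⟨ha, iha⟩ := iha ha
      obtain ⟨hb, ihb⟩ := ihb hb
      exact ⟨mul_mem ha hb, by
        convert add_mem iha ihb; exact homologyClass_mul R ⟨a, ha⟩ ⟨b, hb⟩⟩
    | inv a ha iha =>
      obtain ⟨ha, iha⟩ := iha ha
      exact ⟨inv_mem ha, by convert neg_mem iha; exact homologyClass_inv R ⟨a, ha⟩⟩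
  exact (key m hm).2

lemma homologyRep_gy_loop :
    homologyRep R (gy : TetGroup) (homologyClass R loop) = homologyClass R loop := by
  rw [homologyRep_homologyClass]
  refine congrArg _ (Subtype.ext ?_)
  change gy * gy ^ 2 * gy⁻¹ = gy ^ 2
  group

lemma tetGroup_gz_eq : (gz : TetGroup) = (gy : TetGroup) * (gx : TetGroup) ^ 2 := by
  have h : (gx : TetGroup) ^ 2 = (gx : TetGroup)⁻¹ := by
    rw [eq_inv_iff_mul_eq_one, ← pow_succ, tetGroup_gx_pow_three]
  have h' : (gy : TetGroup) = (gy : TetGroup)⁻¹ := by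
    rw [eq_inv_iff_mul_eq_one, ← sq, tetGroup_gy_sq]
  rw [gz_eq, QuotientGroup.mk_inv, QuotientGroup.mk_mul, mul_inv_rev, h, ← h']

lemma tetGroup_gz_sq : (gz : TetGroup) ^ 2 = (gx : TetGroup) * gy := by
  have h : (gz : TetGroup) ^ 2 = (gz : TetGroup)⁻¹ := by
    rw [eq_inv_iff_mul_eq_one, ← pow_succ, ← QuotientGroup.mk_pow, gz_pow_three]; rfl
  rw [h, gz_eq, QuotientGroup.mk_inv, inv_inv, QuotientGroup.mk_mul]

/-- Puts yx in the coset of x²z modulo the subgroup generated by y, which fixes the class of the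
loop; every translate of the loop then has the form x^i or x^i z applied to it. -/
lemma tetGroup_gy_mul_gx :
    (gy : TetGroup) * gx = (gx : TetGroup) ^ 2 * gz * gy := by
  have hx : (gx : TetGroup) ^ 2 = (gx : TetGroup)⁻¹ := by
    rw [eq_inv_iff_mul_eq_one, ← pow_succ, tetGroup_gx_pow_three]
  have h4 : (gz : TetGroup) = ((gx : TetGroup) * gy)⁻¹ := by
    rw [gz_eq, QuotientGroup.mk_inv, QuotientGroup.mk_mul]
  have h5 : (gz : TetGroup) = ((gx : TetGroup) * gy) ^ 2 := by
    rw [h4, inv_eq_iff_mul_eq_one, ← pow_succ', tetGroup_gx_mul_gy_pow_three]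
  rw [h5, hx]
  simp only [sq, mul_assoc]
  rw [inv_mul_cancel_left, ← sq, tetGroup_gy_sq, mul_one]

/-- The loops around the six punctures, appropriately oriented and connected to the base point,
add up to zero. -/
lemma sum_loops :
    ∑ i : Fin 3, (homologyRep R ((gx : TetGroup) ^ (i : ℕ)) (homologyClass R loop) +
      homologyRep R ((gx : TetGroup) ^ (i : ℕ) * gz) (homologyClass R loop)) = 0 := by
  have h := prod_loops gx_pow_three gz_pow_three (u := gy ^ 2) (by
    rw [← mul_inv_rev, gz_eq, mul_inv_rev, inv_inv]; group)
  have h' : loop * MulAut.conjNormal gz loop * MulAut.conjNormal (gz ^ 2) loop *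
      MulAut.conjNormal (gx * gz) loop * MulAut.conjNormal (gx ^ 2) loop *
      MulAut.conjNormal (gx ^ 2 * gz) loop = 1 := Subtype.ext h
  have h2 := congrArg (homologyClass R) h'
  simp only [homologyClass_mul, ← homologyRep_homologyClass, homologyClass_one] at h2
  have e1 : ((gz ^ 2 : EdgeTriangleGroup) : TetGroup) = (gx : TetGroup) * gy := tetGroup_gz_sq
  have e2 : ((gx * gz : EdgeTriangleGroup) : TetGroup) = (gx : TetGroup) * gz := rfl
  have e3 : ((gx ^ 2 * gz : EdgeTriangleGroup) : TetGroup) = (gx : TetGroup) ^ 2 * gz := rfl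
  have e4 : ((gx ^ 2 : EdgeTriangleGroup) : TetGroup) = (gx : TetGroup) ^ 2 := rfl
  rw [e1, e2, e3, e4, map_mul _ (gx : TetGroup) (gy : TetGroup), Module.End.mul_apply,
    homologyRep_gy_loop] at h2
  simp only [Fin.sum_univ_three, Fin.val_zero, Fin.val_one, Fin.val_two, pow_zero, pow_one,
    map_one, Module.End.one_apply, one_mul]
  rw [← h2]
  abel

/-- Since y fixes the class of the loop, its translates depend only on the coset in G/⟨y⟩. The six
cosets are represented by x^i and x^i z, and `sum_loops` expresses the translate by x²z through the
other five. -/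
lemma exists_spanning_five : ∃ b : Fin 5 → Homology R, Submodule.span R (Set.range b) = ⊤ := by
  set u := homologyClass R loop with hu
  set X : TetGroup := (gx : TetGroup) with hX
  let b : Fin 5 → Homology R := ![homologyRep R (X ^ 0) u, homologyRep R (X ^ 1) u,
    homologyRep R (X ^ 2) u, homologyRep R (X ^ 0 * gz) u, homologyRep R (X ^ 1 * gz) u]
  have hb : ∀ k, b k ∈ Submodule.span R (Set.range b) := fun k => Submodule.subset_span ⟨k, rfl⟩
  have h1 : ∀ n : ℕ, homologyRep R (X ^ n) u ∈ Submodule.span R (Set.range b) := fun n => by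
    rw [pow_eq_pow_mod n tetGroup_gx_pow_three]
    have : n % 3 < 3 := Nat.mod_lt n (by norm_num)
    interval_cases n % 3
    exacts [hb 0, hb 1, hb 2]
  have h2 : ∀ n : ℕ, homologyRep R (X ^ n * gz) u ∈ Submodule.span R (Set.range b) := fun n => by
    rw [pow_eq_pow_mod n tetGroup_gx_pow_three]
    have : n % 3 < 3 := Nat.mod_lt n (by norm_num)
    interval_cases n % 3
    · exact hb 3
    · exact hb 4
    · have h := sum_loops R
      simp only [Fin.sum_univ_three, Fin.val_zero, Fin.val_one, Fin.val_two] at h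
      rw [← add_assoc, add_eq_zero_iff_eq_neg'] at h
      rw [h]
      exact neg_mem (add_mem (add_mem (add_mem (hb 0) (hb 3)) (add_mem (hb 1) (hb 4))) (hb 2))
  refine ⟨b, ?_⟩
  rw [eq_top_iff, ← span_range_homologyRep_loop, Submodule.span_le]
  rintro _ ⟨g, rfl⟩
  rcases tetGroup_normalForm g with ⟨i, rfl⟩ | ⟨i, j, rfl⟩
  · exact h1 _
  · rw [← hX, SetLike.mem_coe]
    fin_cases j
    · have h := h1 i
      rw [hu, ← homologyRep_gy_loop, ← Module.End.mul_apply, ← map_mul] at h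
      simpa using h
    · have h := h2 (i + 2)
      rw [hu, ← homologyRep_gy_loop, ← Module.End.mul_apply, ← map_mul, pow_add, mul_assoc,
        mul_assoc, ← mul_assoc (X ^ 2), hX, ← tetGroup_gy_mul_gx, ← mul_assoc] at h
      simpa only [Fin.mk_one, Fin.val_one, pow_one] using h
    · have h := h2 i
      rw [tetGroup_gz_eq] at h
      simpa [mul_assoc] using h

/-- The linear map on homology which extends a homomorphism to a vector space. -/
noncomputable def homologyLift {R : Type} [CommRing R] {B : Type*} [AddCommGroup B] [Module R B]
    (f : edgePuncturedPi →* Multiplicative B) : Homology R →ₗ[R] B :=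
  LinearMap.liftBaseChange R
    (MonoidHom.toAdditiveLeft (Abelianization.lift f)).toIntLinearMap

lemma homologyLift_homologyClass {R : Type} [CommRing R] {B : Type*} [AddCommGroup B] [Module R B]
    (f : edgePuncturedPi →* Multiplicative B) (m : edgePuncturedPi) :
    homologyLift f (homologyClass R m) = (f m).toAdd := by
  rw [homologyLift, homologyClass, LinearMap.liftBaseChange_tmul, one_smul]
  rfl

end HomologyClass

/-! ### Affine actions of `Δ(3, ∞, 3)` -/

section AffineAction

variable {R : Type} [CommRing R] {V : Type*} [AddCommGroup V] [Module R V]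
  (f : EdgeTriangleGroup →* (V ≃ᵃ[R] V))

/-- The translation part of an affine action is a crossed homomorphism; where the linear parts are
trivial it becomes an honest homomorphism. -/
lemma affine_apply_mul (g h : EdgeTriangleGroup) :
    f (g * h) 0 = (f g).linear (f h 0) + f g 0 := by
  rw [map_mul, AffineEquiv.mul_def, AffineEquiv.trans_apply]
  simpa using (f g).map_vadd 0 (f h 0)

variable (hf : ∀ m ∈ edgePuncturedPi, ∀ v, (f m).linear v = v)

/-- If the linear parts factor through `G`, the translation parts of the elements of the
fundamental group define a linear map on homology. -/
noncomputable def translationMap : Homology R →ₗ[R] V :=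
  homologyLift
    { toFun := fun m : edgePuncturedPi => Multiplicative.ofAdd (f m 0)
      map_one' := by simp
      map_mul' := fun m n => by
        rw [← ofAdd_add, Subgroup.coe_mul, affine_apply_mul, hf _ m.2, add_comm] }

lemma translationMap_homologyClass (m : edgePuncturedPi) :
    translationMap f hf (homologyClass R m) = f m 0 :=
  homologyLift_homologyClass _ m

/-- Equivariance comes from expanding the translation part of `(g * m * g⁻¹) * g = g * m` in two
ways: the term `f g 0` cancels because both `m` and its conjugate have trivial linear part. -/
lemma translationMap_homologyRep (g : EdgeTriangleGroup) (h : Homology R) :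
    translationMap f hf (homologyRep R (g : TetGroup) h) =
      (f g).linear (translationMap f hf h) := by
  have : translationMap f hf ∘ₗ homologyRep R (g : TetGroup) =
      (f g).linear.toLinearMap ∘ₗ translationMap f hf := by
    refine homology_hom_ext fun m => ?_
    simp only [LinearMap.comp_apply, homologyRep_homologyClass, translationMap_homologyClass,
      LinearEquiv.coe_coe]
    rw [MulAut.conjNormal_apply]
    have h1 : f (g * m * g⁻¹ * g) 0 = f (g * m) 0 := by rw [inv_mul_cancel_right]
    rw [affine_apply_mul, affine_apply_mul f g,
      hf _ (Subgroup.Normal.conj_mem inferInstance _ m.2 g), add_comm, add_right_cancel_iff] at h1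
    exact h1
  exact LinearMap.congr_fun this h

end AffineAction

/-! ### Coordinates on the homology of the punctured sphere -/

section Coordinates

variable {F : Type} [Field F] {a b c : F}

/-- The linear part of the action of `x`: a matrix with trace `-1` and determinant `1` on the first
two coordinates, and a cyclic permutation of the others. -/
def linX (h : a ^ 2 + a + 1 + b * c = 0) : (Fin 5 → F) ≃ₗ[F] (Fin 5 → F) where
  toFun v := ![a * v 0 + b * v 1, c * v 0 + (-1 - a) * v 1, v 4, v 2, v 3]
  invFun v := ![(-1 - a) * v 0 - b * v 1, -c * v 0 + a * v 1, v 3, v 4, v 2]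
  map_add' v w := by ext k; fin_cases k <;> simp <;> ring
  map_smul' r v := by ext k; fin_cases k <;> simp <;> ring
  left_inv v := by
    ext k; fin_cases k <;> simp
    · linear_combination (-v 0) * h
    · linear_combination (-v 1) * h
  right_inv v := by
    ext k; fin_cases k <;> simp
    · linear_combination (-v 0) * h
    · linear_combination (-v 1) * h

/-- The linear part of the action of `y`. -/
def linY (F : Type) [Field F] : (Fin 5 → F) ≃ₗ[F] (Fin 5 → F) :=
  LinearEquiv.ofInvolutive
    { toFun := fun v => ![v 0, v 1, v 2, -v 3, -v 4]
      map_add' := fun v w => by ext k; fin_cases k <;> simp <;> ring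
      map_smul' := fun r v => by ext k; fin_cases k <;> simp }
    (fun v => by ext k; fin_cases k <;> simp)

lemma linX_apply (h : a ^ 2 + a + 1 + b * c = 0) (v : Fin 5 → F) :
    linX h v = ![a * v 0 + b * v 1, c * v 0 + (-1 - a) * v 1, v 4, v 2, v 3] := rfl

lemma linY_apply (v : Fin 5 → F) : linY F v = ![v 0, v 1, v 2, -v 3, -v 4] := rfl

/-- The affine action of `y`. -/
def affY (t : Fin 2 → F) : (Fin 5 → F) ≃ᵃ[F] (Fin 5 → F) :=
  -- On the plane any translation is allowed, as 1 + x + x² = 0 there. On the monomial block, (1, 0,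
  -- 0) alone would violate `(x * y) ^ 3 = 1`; the second entry 1 repairs this, and cancels in y²
  -- because y negates that coordinate.
  AffineEquiv.constVAdd F (Fin 5 → F) ![t 0, t 1, 1, 1, 0] * (linY F).toAffineEquiv

lemma affY_apply (t : Fin 2 → F) (v : Fin 5 → F) :
    affY t v = ![t 0 + v 0, t 1 + v 1, 1 + v 2, 1 + -v 3, -v 4] := by
  ext k
  fin_cases k <;> simp [affY, AffineEquiv.mul_def, linY_apply]

/-- The affine action of `Δ(3, ∞, 3)` whose translation parts are coordinates for the homology. -/
noncomputable def affAction (h : a ^ 2 + a + 1 + b * c = 0) (t : Fin 2 → F) :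
    EdgeTriangleGroup →* ((Fin 5 → F) ≃ᵃ[F] (Fin 5 → F)) :=
  deltaLift (linX h).toAffineEquiv (affY t)
    (by
      ext v k
      simp only [pow_three, AffineEquiv.mul_def, AffineEquiv.trans_apply,
        LinearEquiv.coe_toAffineEquiv, linX_apply, AffineEquiv.one_def, AffineEquiv.refl_apply]
      fin_cases k <;> simp
      · linear_combination ((a - 1) * v 0 + b * v 1) * h
      · linear_combination (c * v 0 + (-a - 2) * v 1) * h)
    (by
      ext v k
      simp only [pow_three, AffineEquiv.mul_def, AffineEquiv.trans_apply, affY_apply,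
        LinearEquiv.coe_toAffineEquiv, linX_apply, AffineEquiv.one_def, AffineEquiv.refl_apply]
      fin_cases k <;> simp
      · linear_combination ((a - 1) * v 0 + b * v 1 + a * t 0 + b * t 1) * h
      · linear_combination (c * v 0 + (-a - 2) * v 1 + c * t 0 + (-a - 1) * t 1) * h)

variable (h : a ^ 2 + a + 1 + b * c = 0) (t : Fin 2 → F)

lemma affAction_gx_linear : (affAction h t gx).linear = linX h := by
  rw [affAction, deltaLift_gx]; rfl

lemma affAction_gy_linear : (affAction h t gy).linear = linY F := by
  rw [affAction, deltaLift_gy]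
  rfl

lemma affAction_linear (m : EdgeTriangleGroup) (hm : m ∈ edgePuncturedPi) (v : Fin 5 → F) :
    (affAction h t m).linear v = v := by
  -- The linear part of y is an involution, so taking linear parts kills y² and hence M.
  have := edgePuncturedPi_le_ker (AffineEquiv.linearHom.comp (affAction h t)) (by
    ext v k
    simp only [MonoidHom.comp_apply, AffineEquiv.linearHom_apply, affAction_gy_linear, sq,
      LinearEquiv.mul_apply, linY_apply]
    fin_cases k <;> simp) hm
  exact LinearEquiv.congr_fun (MonoidHom.mem_ker.mp this) v

lemma affAction_loop : affAction h t loop 0 = ![2 * t 0, 2 * t 1, 2, 0, 0] := by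
  change affAction h t (gy ^ 2) 0 = _
  rw [map_pow, affAction, deltaLift_gy, sq, AffineEquiv.mul_def, AffineEquiv.trans_apply,
    affY_apply, affY_apply]
  ext k; fin_cases k <;> simp <;> ring

/-- A subspace which is stable under `x` and `y`. -/
def IsStable (h : a ^ 2 + a + 1 + b * c = 0) (U : Submodule F (Fin 5 → F)) : Prop :=
  (∀ u ∈ U, linX h u ∈ U) ∧ ∀ u ∈ U, linY F u ∈ U

variable {h} {U : Submodule F (Fin 5 → F)}

/-- The operator (1 + x y x²)(1 + y)/4 is the projection onto the plane. On the plane y = 1 and x³ =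
1, so it is the identity; on the monomial block 1 + y leaves only a multiple of the first basis
vector, which x y x² negates. -/
lemma IsStable.proj_mem (h2 : (2 : F) ≠ 0) (hU : IsStable h U) {u : Fin 5 → F} (hu : u ∈ U) :
    ![u 0, u 1, 0, 0, 0] ∈ U := by
  obtain ⟨hX, hY⟩ := hU
  have h1 := add_mem hu (hY _ hu)
  have h3 := hX _ (hY _ (hX _ (hX _ h1)))
  have h4 := U.smul_mem ((2 * 2)⁻¹ : F) (add_mem h1 h3)
  convert h4 using 1
  ext k
  simp only [linX_apply, linY_apply]
  fin_cases k <;> simp [Matrix.vecHead, Matrix.vecTail] <;> field_simp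
  · linear_combination (-2 * u 0 * (a - 1) - 2 * u 1 * b) * h
  · linear_combination (-2 * u 0 * c + 2 * u 1 * (a + 2)) * h

/-- After the plane part is subtracted, 1 + y isolates coordinate 2. Powers of x first bring a
non-zero coordinate to this position and afterwards carry the basis vector to the other two. -/
lemma IsStable.single_mem (h2 : (2 : F) ≠ 0) (hU : IsStable h U) {u : Fin 5 → F} (hu : u ∈ U)
    {k : Fin 5} (hk : 2 ≤ k) (huk : u k ≠ 0) {k' : Fin 5} (hk' : 2 ≤ k') :
    Pi.single k' 1 ∈ U := by
  have key : ∀ w ∈ U, w 2 ≠ 0 → Pi.single 2 1 ∈ U := fun w hw hw2 => by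
    have h1 := sub_mem hw (hU.proj_mem h2 hw)
    have h3 := U.smul_mem ((2 * w 2)⁻¹ : F) (add_mem h1 (hU.2 _ h1))
    convert h3 using 1
    ext k
    simp only [linY_apply]
    fin_cases k <;> simp [Matrix.vecHead, Matrix.vecTail]
    field_simp
    ring
  have h2U : Pi.single 2 1 ∈ U := by
    fin_cases k
    · exact absurd hk (by decide)
    · exact absurd hk (by decide)
    · exact key u hu huk
    · exact key _ (hU.1 _ (hU.1 _ hu)) (by simpa [linX_apply] using huk)
    · exact key _ (hU.1 _ hu) (by simpa [linX_apply] using huk)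
  have h3U : Pi.single 3 1 ∈ U := by
    convert hU.1 _ h2U using 1
    ext k; fin_cases k <;> simp [linX_apply]
  have h4U : Pi.single 4 1 ∈ U := by
    convert hU.1 _ h3U using 1
    ext k; fin_cases k <;> simp [linX_apply]
  fin_cases k'
  · exact absurd hk' (by decide)
  · exact absurd hk' (by decide)
  · exact h2U
  · exact h3U
  · exact h4U

/-- Cramer's rule in the plane of the first two coordinates. -/
lemma single_mem_of_det_ne_zero {u0 u1 w0 w1 : F} (hu : ![u0, u1, 0, 0, 0] ∈ U)
    (hw : ![w0, w1, 0, 0, 0] ∈ U) (hdet : u0 * w1 - u1 * w0 ≠ 0) {k : Fin 5} (hk : k < 2) :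
    Pi.single k 1 ∈ U := by
  fin_cases k
  · convert U.smul_mem (u0 * w1 - u1 * w0)⁻¹ (sub_mem (U.smul_mem w1 hu) (U.smul_mem u1 hw)) using 1
    ext k; fin_cases k <;> simp [hdet] <;> field_simp ; ring
  · convert U.smul_mem (u0 * w1 - u1 * w0)⁻¹ (sub_mem (U.smul_mem u0 hw) (U.smul_mem w0 hu)) using 1
    ext k; fin_cases k <;> simp [hdet] <;> field_simp ; ring
  all_goals exact absurd hk (by decide)

/-- The expression in `hdet` is the determinant of the plane parts of u and xu; it is non-zero
exactly when u projects to a cyclic vector of x. -/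
lemma IsStable.single_mem_of_cyclic (h2 : (2 : F) ≠ 0) (hU : IsStable h U) {u : Fin 5 → F}
    (hu : u ∈ U) (hdet : u 0 * (c * u 0 + (-1 - a) * u 1) - u 1 * (a * u 0 + b * u 1) ≠ 0)
    {k : Fin 5} (hk : k < 2) : Pi.single k 1 ∈ U := by
  have h1 := hU.proj_mem h2 hu
  have h3 := hU.1 _ h1
  rw [linX_apply] at h3
  exact single_mem_of_det_ne_zero h1 (by simpa using h3) hdet hk

/-- Coordinates on `H₁(S; F)` in which `G` acts by explicit matrices. -/
theorem exists_coordinates (h2 : (2 : F) ≠ 0) (h : a ^ 2 + a + 1 + b * c = 0) (t : Fin 2 → F)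
    (ht : t 0 * (c * t 0 + (-1 - a) * t 1) - t 1 * (a * t 0 + b * t 1) ≠ 0) :
    ∃ T : Homology F ≃ₗ[F] (Fin 5 → F),
      (∀ v, T (homologyRep F (gx : TetGroup) v) = linX h (T v)) ∧
      ∀ v, T (homologyRep F (gy : TetGroup) v) = linY F (T v) := by
  set T := translationMap (affAction h t) (affAction_linear h t) with hT
  have hx : ∀ v, T (homologyRep F (gx : TetGroup) v) = linX h (T v) := fun v => by
    rw [hT, translationMap_homologyRep, affAction_gx_linear]
  have hy : ∀ v, T (homologyRep F (gy : TetGroup) v) = linY F (T v) := fun v => by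
    rw [hT, translationMap_homologyRep, affAction_gy_linear]
  have hU : IsStable h (LinearMap.range T) := by
    constructor
    · rintro _ ⟨v, rfl⟩
      exact ⟨_, hx v⟩
    · rintro _ ⟨v, rfl⟩
      exact ⟨_, hy v⟩
  have hu : ![2 * t 0, 2 * t 1, 2, 0, 0] ∈ LinearMap.range T :=
    ⟨homologyClass F loop, by rw [hT, translationMap_homologyClass, affAction_loop]⟩
  have hsurj : Function.Surjective T := by
    rw [← LinearMap.range_eq_top, eq_top_iff, ← (Pi.basisFun F (Fin 5)).span_eq,
      Submodule.span_le]
    rintro _ ⟨k, rfl⟩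
    rw [Pi.basisFun_apply]
    by_cases hk : k < 2
    · refine hU.single_mem_of_cyclic h2 hu ?_ hk
      -- The plane part of the image of the loop is 2t, and the determinant is quadratic, whence the
      -- factor 2 · 2.
      convert mul_ne_zero (mul_ne_zero h2 h2) ht using 1
      simp
      ring
    · exact hU.single_mem h2 hu (k := 2) le_rfl (by simpa using h2) (not_lt.mp hk)
  obtain ⟨b, hb⟩ := exists_spanning_five F
  classical
  have hfin : Module.Finite F (Homology F) := ⟨⟨Finset.univ.image b, by simpa using hb⟩⟩
  have hle : Module.finrank F (Homology F) ≤ 5 := by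
    have := finrank_range_le_card (R := F) b
    rwa [Set.finrank, hb, finrank_top, Fintype.card_fin] at this
  have heq : Module.finrank F (Homology F) = Module.finrank F (Fin 5 → F) := by
    refine le_antisymm (by simpa using hle) (LinearMap.finrank_le_finrank_of_surjective hsurj)
  have hinj : Function.Injective T :=
    (LinearMap.injective_iff_surjective_of_finrank_eq_finrank heq).mpr hsurj
  exact ⟨LinearEquiv.ofBijective T ⟨hinj, hsurj⟩, hx, hy⟩

end Coordinates

/-! ### Block decompositions of representations -/

section Blocks

set_option linter.unusedSectionVars false

variable {F G V κ ι : Type*} [Field F] [Group G] [AddCommGroup V] [Module F V]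
  [Fintype κ] [DecidableEq κ] [Fintype ι] [DecidableEq ι]
  (ρ : Representation F G V) (T : V ≃ₗ[F] (κ → F)) (ℓ : κ → ι)

/-- The vectors whose coordinates vanish outside of the blocks in `S`. -/
def blockSum (S : Finset ι) : Submodule F V where
  carrier := {v | ∀ k, ℓ k ∉ S → T v k = 0}
  zero_mem' := fun k _ => by simp
  add_mem' := fun {v w} hv hw k hk => by simp [hv k hk, hw k hk]
  smul_mem' := fun r v hv k hk => by simp [hv k hk]

variable {T ℓ}

lemma mem_blockSum {S : Finset ι} {v : V} :
    v ∈ blockSum T ℓ S ↔ ∀ k, ℓ k ∉ S → T v k = 0 := Iff.rfl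

lemma symm_single_mem_blockSum {S : Finset ι} {k : κ} :
    T.symm (Pi.single k 1) ∈ blockSum T ℓ S ↔ ℓ k ∈ S := by
  rw [mem_blockSum]
  constructor
  · intro h
    by_contra hk
    simpa using h k hk
  · intro h j hj
    have : j ≠ k := by rintro rfl; exact hj h
    simp [this]

lemma eq_sum_symm_single (v : V) : v = ∑ k, T v k • T.symm (Pi.single k 1) := by
  apply T.injective
  rw [map_sum]
  ext j
  simp [Pi.single_apply]

lemma blockSum_le_iff {S : Finset ι} {W : Submodule F V} :
    blockSum T ℓ S ≤ W ↔ ∀ k, ℓ k ∈ S → T.symm (Pi.single k 1) ∈ W := by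
  constructor
  · intro h k hk
    exact h (symm_single_mem_blockSum.mpr hk)
  · intro h v hv
    rw [eq_sum_symm_single (T := T) v]
    refine sum_mem fun k _ => ?_
    by_cases hk : ℓ k ∈ S
    · exact W.smul_mem _ (h k hk)
    · rw [hv k hk, zero_smul]
      exact zero_mem _

lemma blockSum_le_blockSum (hℓ : Function.Surjective ℓ) {S S' : Finset ι} :
    blockSum T ℓ S ≤ blockSum T ℓ S' ↔ S ⊆ S' := by
  rw [blockSum_le_iff]
  constructor
  · intro h i hi
    obtain ⟨k, rfl⟩ := hℓ i
    exact symm_single_mem_blockSum.mp (h k hi)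
  · intro h k hk
    exact symm_single_mem_blockSum.mpr (h hk)

lemma blockSum_injective (hℓ : Function.Surjective ℓ) : Function.Injective (blockSum T ℓ) :=
  fun _ _ h => Finset.Subset.antisymm ((blockSum_le_blockSum hℓ).mp h.le)
    ((blockSum_le_blockSum hℓ).mp h.ge)

variable (T ℓ)

/-- The coordinates of the vectors of a block sum. -/
def blockSumEquiv (S : Finset ι) : blockSum T ℓ S ≃ₗ[F] ({k // ℓ k ∈ S} → F) where
  toFun v k := T v k
  map_add' v w := by ext k; simp
  map_smul' r v := by ext k; simp
  invFun f := ⟨T.symm fun k => if hk : ℓ k ∈ S then f ⟨k, hk⟩ else 0, fun k hk => by simp [hk]⟩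
  left_inv v := by
    apply Subtype.ext
    apply T.injective
    ext k
    by_cases hk : ℓ k ∈ S
    · simp [hk]
    · simp [hk, v.2 k hk]
  right_inv f := by ext k; simp [k.2]

lemma finrank_blockSum (S : Finset ι) :
    Module.finrank F (blockSum T ℓ S) = (Finset.univ.filter fun k => ℓ k ∈ S).card := by
  rw [(blockSumEquiv T ℓ S).finrank_eq, Module.finrank_pi, Fintype.card_subtype]

/-- The blocks form an internal direct sum. -/
lemma isInternal_blockSum :
    DirectSum.IsInternal fun i => blockSum T ℓ {i} := by
  rw [DirectSum.isInternal_submodule_iff_iSupIndep_and_iSup_eq_top]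
  constructor
  · rw [iSupIndep_def]
    intro i
    have hle : (⨆ (j) (_ : j ≠ i), blockSum T ℓ {j}) ≤ blockSum T ℓ {i}ᶜ := by
      refine iSup₂_le fun j hj => ?_
      rw [blockSum_le_iff]
      intro k hk
      rw [symm_single_mem_blockSum]
      simp_all
    refine Disjoint.mono_right hle ?_
    rw [Submodule.disjoint_def]
    intro v hv hv'
    apply T.injective
    ext k
    rw [map_zero, Pi.zero_apply]
    by_cases hk : ℓ k = i
    · exact hv' k (by simpa using hk)
    · exact hv k (by simpa using hk)
  · rw [eq_top_iff]
    intro v _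
    rw [eq_sum_symm_single (T := T) v]
    refine sum_mem fun k _ => Submodule.smul_mem _ _ ?_
    exact Submodule.mem_iSup_of_mem (ℓ k) (symm_single_mem_blockSum.mpr (by simp))

variable {ρ}

/-- The trace of an endomorphism which preserves a block sum. -/
lemma trace_restrict_blockSum (S : Finset ι) (f : V →ₗ[F] V)
    (hf : ∀ v ∈ blockSum T ℓ S, f v ∈ blockSum T ℓ S) :
    LinearMap.trace F (blockSum T ℓ S) (f.restrict hf) =
      ∑ k : κ with ℓ k ∈ S, T (f (T.symm (Pi.single k 1))) k := by
  rw [← LinearMap.trace_conj' _ (blockSumEquiv T ℓ S),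
    LinearMap.trace_eq_matrix_trace F (Pi.basisFun F {k // ℓ k ∈ S}), Matrix.trace,
    ← Finset.sum_subtype_eq_sum_filter, Finset.subtype_univ]
  refine Finset.sum_congr rfl fun k _ => ?_
  rw [Matrix.diag_apply, LinearMap.toMatrix_apply, Pi.basisFun_repr, Pi.basisFun_apply,
    LinearEquiv.conj_apply_apply]
  change T (f ((blockSumEquiv T ℓ S).symm (Pi.single k 1) : V)) k = _
  suffices h : ((blockSumEquiv T ℓ S).symm (Pi.single k 1) : V) = T.symm (Pi.single (k : κ) 1) by
    rw [h]
  apply T.injective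
  change T (T.symm _) = _
  rw [LinearEquiv.apply_symm_apply, LinearEquiv.apply_symm_apply]
  ext j
  by_cases hj : j = k
  · subst hj; simp [k.2]
  · have : ∀ h, (⟨j, h⟩ : {k // ℓ k ∈ S}) ≠ k := fun h h' => hj (congrArg Subtype.val h')
    simp [hj, this]

variable (ρ)

/-- All vectors of a block are in each stable subspace which has a vector with a non-zero
coordinate in this block. -/
def HasSimpleBlocks : Prop :=
  ∀ W : Submodule F V, (∀ g, ∀ w ∈ W, ρ g w ∈ W) → ∀ w ∈ W, ∀ k, T w k ≠ 0 →
    ∀ k', ℓ k' = ℓ k → T.symm (Pi.single k' 1) ∈ W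

variable {ρ T ℓ}

/-- S collects the blocks in which some vector of W has a non-zero coordinate; simplicity puts each
such block inside W, and W has no coordinates elsewhere. -/
lemma HasSimpleBlocks.exists_eq_blockSum (h : HasSimpleBlocks ρ T ℓ) {W : Submodule F V}
    (hW : ∀ g, ∀ w ∈ W, ρ g w ∈ W) : ∃ S, W = blockSum T ℓ S := by
  classical
  refine ⟨Finset.univ.filter fun i => ∃ k, ℓ k = i ∧ ∃ w ∈ W, T w k ≠ 0, le_antisymm ?_ ?_⟩
  · intro w hw k hk
    by_contra hne
    exact hk (by simpa using ⟨k, rfl, w, hw, hne⟩)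
  · rw [blockSum_le_iff]
    intro k hk
    obtain ⟨k', hk', w, hw, hne⟩ := (Finset.mem_filter.mp hk).2
    exact h W hW w hw k' hne k hk'.symm

/-- A block of a decomposition into simple blocks, as a subrepresentation. -/
def blockRep (hT : ∀ g S, ∀ v ∈ blockSum T ℓ S, ρ g v ∈ blockSum T ℓ S) (i : ι) :
    Subrepresentation ρ := ⟨blockSum T ℓ {i}, fun g v hv => hT g {i} v hv⟩

lemma HasSimpleBlocks.isIrreducible (h : HasSimpleBlocks ρ T ℓ) (hℓ : Function.Surjective ℓ)
    (hT : ∀ g S, ∀ v ∈ blockSum T ℓ S, ρ g v ∈ blockSum T ℓ S) (i : ι) :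
    (blockRep hT i).toRepresentation.IsIrreducible := by
  obtain ⟨k, hk⟩ := hℓ i
  have hmem : T.symm (Pi.single k 1) ∈ blockSum T ℓ {i} :=
    symm_single_mem_blockSum.mpr (by simpa using hk)
  refine { exists_pair_ne := ⟨⊥, ⊤, fun hbt => ?_⟩, eq_bot_or_eq_top := fun W => ?_ }
  · have h1 : (⊥ : Submodule F (blockSum T ℓ {i})) = ⊤ :=
      congrArg Subrepresentation.toSubmodule hbt
    have h2 : (⟨_, hmem⟩ : blockSum T ℓ {i}) ∈ (⊥ : Submodule F (blockSum T ℓ {i})) := by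
      rw [h1]; trivial
    rw [Submodule.mem_bot, Subtype.ext_iff, Submodule.coe_zero, LinearEquiv.map_eq_zero_iff] at h2
    simpa using congrFun h2 k
  · by_cases hW : W.toSubmodule = ⊥
    · exact .inl (Subrepresentation.toSubmodule_injective hW)
    · right
      apply Subrepresentation.toSubmodule_injective
      change W.toSubmodule = ⊤
      rw [← ne_eq, Submodule.ne_bot_iff] at hW
      obtain ⟨w, hw, hw0⟩ := hW
      obtain ⟨j, hj⟩ : ∃ j, T w j ≠ 0 := by
        by_contra! hc
        apply hw0
        apply Subtype.ext
        apply T.injective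
        ext j
        simpa using hc j
      have hji : ℓ j = i := by
        by_contra hne
        exact hj (w.2 j (by simpa using hne))
      -- The simplicity hypothesis concerns subspaces of V, so it is applied to the image of W under
      -- inclusion.
      have hle : blockSum T ℓ {i} ≤ W.toSubmodule.map (blockSum T ℓ {i}).subtype := by
        rw [blockSum_le_iff]
        intro k' hk'
        refine h _ ?_ w (Submodule.mem_map_of_mem hw) j hj k' (by simpa [hji] using hk')
        rintro g _ ⟨u, hu, rfl⟩
        exact ⟨_, W.apply_mem_toSubmodule g hu, rfl⟩
      rw [eq_top_iff]
      rintro v -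
      obtain ⟨u, hu, huv⟩ := hle v.2
      rwa [← Subtype.ext huv]

end Blocks

/-! ### Characters -/

lemma tetGroup_induction {P : TetGroup → Prop} (one : P 1) (hx : ∀ g, P g → P (gx * g))
    (hy : ∀ g, P g → P (gy * g)) (g : TetGroup) : P g := by
  have key : ∀ (n : ℕ) (g : TetGroup), P g → P ((gx : TetGroup) ^ n * g) := fun n g hg => by
    induction n with
    | zero => simpa using hg
    | succ n ih => rw [pow_succ', mul_assoc]; exact hx _ ih
  rcases tetGroup_normalForm g with ⟨i, rfl⟩ | ⟨i, j, rfl⟩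
  · simpa using key i 1 one
  · have := key i _ (hy _ (key j 1 one))
    simpa [mul_assoc] using this

lemma stable_of_stable_gens {R : Type} [CommRing R] {W : Submodule R (Homology R)}
    (hx : ∀ w ∈ W, homologyRep R (gx : TetGroup) w ∈ W)
    (hy : ∀ w ∈ W, homologyRep R (gy : TetGroup) w ∈ W) (g : TetGroup) :
    ∀ w ∈ W, homologyRep R g w ∈ W := by
  induction g using tetGroup_induction with
  | one => intro w hw; simpa using hw
  | hx g ih => intro w hw; rw [map_mul]; exact hx _ (ih w hw)
  | hy g ih => intro w hw; rw [map_mul]; exact hy _ (ih w hw)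

/-- The linear character of `G` which maps `x` to a given cube root of unity, and `y` to `1`. -/
noncomputable def linChar {F : Type} [Field F] (u : Fˣ) (hu : u ^ 3 = 1) : TetGroup →* F :=
  (Units.coeHom F).comp (QuotientGroup.lift edgePuncturedPi
    (deltaLift u 1 hu (by rw [mul_one, hu])) (edgePuncturedPi_le_ker _ (by simp)))

section linChar

variable {F : Type} [Field F] (u : Fˣ) (hu : u ^ 3 = 1)

@[simp] lemma linChar_gx : linChar u hu gx = u :=
  congrArg Units.val (deltaLift_gx u 1 hu (by rw [mul_one, hu]))

@[simp] lemma linChar_gy : linChar u hu gy = 1 :=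
  congrArg Units.val (deltaLift_gy u 1 hu (by rw [mul_one, hu]))

lemma linChar_pow_three (g : TetGroup) : linChar u hu g ^ 3 = 1 := by
  induction g using tetGroup_induction with
  | one => simp
  | hx g ih =>
    rw [map_mul, mul_pow, ih, linChar_gx, mul_one]
    rw [← Units.val_pow_eq_pow_val, hu, Units.val_one]
  | hy g ih => rw [map_mul, mul_pow, ih, linChar_gy, mul_one, one_pow]

end linChar

lemma A4_trichotomy (h : A4) : h ^ 2 = 1 ∨ IsConj threeCycle h ∨ IsConj threeCycle h⁻¹ := by
  simp only [isConj_iff]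
  revert h
  decide

/-- Each isomorphism from `G` to `A₄` takes a non-trivial linear character and its square to
`χ₂` and `χ₃`, for a suitable choice of the cube root of unity. -/
lemma exists_eq_chi2 {F : Type} [Field F] (χ : TetGroup →* F) (h3 : ∀ g, χ g ^ 3 = 1)
    (hx : χ gx ≠ 1) (e : TetGroup ≃* A4) :
    ∃ ω : F, IsPrimitiveRoot ω 3 ∧ (∀ g, χ g = chi2 ω (e g)) ∧ ∀ g, χ g ^ 2 = chi3 ω (e g) := by
  have hsq : ∀ g, g ^ 2 = 1 → χ g = 1 := fun g hg => by
    have h2 : χ g ^ 2 = 1 := by rw [← map_pow, hg, map_one]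
    have := h3 g
    rwa [pow_succ, h2, one_mul] at this
  have hconj : ∀ g, IsConj threeCycle (e g) → χ g = χ (e.symm threeCycle) := fun g hg => by
    have := (χ.comp e.symm.toMonoidHom).map_isConj hg
    rw [isConj_iff_eq] at this
    simpa using this.symm
  have hinv : ∀ g, χ g⁻¹ = χ g ^ 2 := fun g => by
    have h1 : χ g⁻¹ * χ g = 1 := by rw [← map_mul, inv_mul_cancel, map_one]
    calc χ g⁻¹ = χ g⁻¹ * χ g ^ 3 := by rw [h3, mul_one]
      _ = (χ g⁻¹ * χ g) * χ g ^ 2 := by ring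
      _ = χ g ^ 2 := by rw [h1, one_mul]
  have hinvconj : ∀ g, IsConj threeCycle (e g)⁻¹ → χ g = χ (e.symm threeCycle) ^ 2 :=
    fun g hg => by
      rw [← map_inv] at hg
      rw [← hconj _ hg, ← hinv, inv_inv]
  have hsq' : ∀ g, (e g) ^ 2 = 1 → g ^ 2 = 1 := fun g hg =>
    e.injective (by rw [map_pow, hg, map_one])
  -- An isomorphism with A₄ may exchange the two classes of 3-cycles, so the root of unity has to be
  -- read off through `e`.
  set ω := χ (e.symm threeCycle) with hω
  have hω3 : ω ^ 3 = 1 := h3 _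
  refine ⟨ω, ?_, fun g => ?_, fun g => ?_⟩
  · rw [IsPrimitiveRoot.iff_orderOf]
    refine orderOf_eq_prime hω3 fun h1 => hx ?_
    rcases A4_trichotomy (e gx) with h | h | h
    · exact hsq _ (hsq' _ h)
    · rw [hconj _ h, h1]
    · rw [hinvconj _ h, h1, one_pow]
  · rw [chi2]
    split_ifs with h h'
    · exact hsq _ (hsq' _ h)
    · exact hconj _ h'
    · exact hinvconj _ (((A4_trichotomy _).resolve_left h).resolve_left h')
  · rw [chi3]
    split_ifs with h h'
    · rw [hsq _ (hsq' _ h), one_pow]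
    · rw [hconj _ h']
    · rw [hinvconj _ (((A4_trichotomy _).resolve_left h).resolve_left h'), ← pow_mul,
        pow_succ, hω3, one_mul]

/-- The sum does not involve ω, so it makes sense, and can be computed, over fields without cube
roots of unity. -/
lemma chi2_add_chi3 {R : Type} [CommRing R] {ω : R} (hω : 1 + ω + ω ^ 2 = 0) (h : A4) :
    chi2 ω h + chi3 ω h = if h ^ 2 = 1 then 2 else -1 := by
  rw [chi2, chi3]
  split_ifs
  · norm_num
  · linear_combination hω
  · linear_combination hω

lemma one_add_add_sq_eq_zero {F : Type} [CommRing F] [IsDomain F] {ω : F}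
    (hω : IsPrimitiveRoot ω 3) : 1 + ω + ω ^ 2 = 0 := by
  have := hω.geom_sum_eq_zero (by norm_num)
  simpa [Finset.sum_range_succ] using this

lemma map_sq_eq_one_iff (e e' : TetGroup ≃* A4) (g : TetGroup) :
    e g ^ 2 = 1 ↔ e' g ^ 2 = 1 := by
  rw [← map_pow, ← map_pow, MulEquiv.map_eq_one_iff, MulEquiv.map_eq_one_iff]

/-- χ₄ depends only on whether an element or its square is trivial, hence not on the identification
of G with A₄. -/
lemma chi4_eq (R : Type) [CommRing R] (e e' : TetGroup ≃* A4) (g : TetGroup) :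
    chi4 R (e g) = chi4 R (e' g) := by
  have h : e g = 1 ↔ e' g = 1 := by rw [MulEquiv.map_eq_one_iff, MulEquiv.map_eq_one_iff]
  simp only [chi4, map_sq_eq_one_iff e e', h]

lemma sq_eq_one_pow (i : Fin 3) : (threeCycle ^ (i : ℕ)) ^ 2 = 1 ↔ i = 0 := by
  revert i; decide

lemma eq_one_pow (i : Fin 3) : threeCycle ^ (i : ℕ) = 1 ↔ i = 0 := by
  revert i; decide

lemma sq_eq_one_pow_mul_pow (i j : Fin 3) :
    (threeCycle ^ (i : ℕ) * doubleTransposition * threeCycle ^ (j : ℕ)) ^ 2 = 1 ↔ i + j = 0 := by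
  revert i j; decide

lemma ne_one_pow_mul_pow (i j : Fin 3) :
    threeCycle ^ (i : ℕ) * doubleTransposition * threeCycle ^ (j : ℕ) ≠ 1 := by
  revert i j; decide

lemma tetGroupEquiv_gx : tetGroupEquiv gx = threeCycle := by
  rw [tetGroupEquiv_mk, toA4, deltaLift_gx]

lemma tetGroupEquiv_gy : tetGroupEquiv gy = doubleTransposition := by
  rw [tetGroupEquiv_mk, toA4, deltaLift_gy]

section Traces

variable {F : Type} [Field F] {a b c : F} {h : a ^ 2 + a + 1 + b * c = 0}
  {T : Homology F ≃ₗ[F] (Fin 5 → F)}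
  (hTx : ∀ v, T (homologyRep F (gx : TetGroup) v) = linX h (T v))
  (hTy : ∀ v, T (homologyRep F (gy : TetGroup) v) = linY F (T v))

include hTx in
lemma apply_homologyRep_gx_pow (n : ℕ) (v : Homology F) :
    T (homologyRep F ((gx : TetGroup) ^ n) v) = (linX h)^[n] (T v) := by
  induction n with
  | zero => simp
  | succ n ih => rw [pow_succ', map_mul, Module.End.mul_apply, hTx, ih,
      Function.iterate_succ_apply']

include hTx hTy in
-- The last three coordinates form a monomial representation, whose diagonal entries are evaluated
-- on the twelve normal forms. The formula holds for every choice of the plane block.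
lemma sum_diag_eq_chi4 (e : TetGroup ≃* A4) (g : TetGroup) :
    T (homologyRep F g (T.symm (Pi.single 2 1))) 2 +
      T (homologyRep F g (T.symm (Pi.single 3 1))) 3 +
      T (homologyRep F g (T.symm (Pi.single 4 1))) 4 = chi4 F (e g) := by
  rw [chi4_eq F e tetGroupEquiv]
  rcases tetGroup_normalForm g with ⟨i, rfl⟩ | ⟨i, j, rfl⟩
  · simp only [chi4, map_pow tetGroupEquiv, tetGroupEquiv_gx, eq_one_pow, sq_eq_one_pow,
      apply_homologyRep_gx_pow hTx, LinearEquiv.apply_symm_apply]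
    fin_cases i <;> simp [linX_apply] ; norm_num
  · simp only [chi4, map_mul tetGroupEquiv, map_pow tetGroupEquiv, tetGroupEquiv_gx,
      tetGroupEquiv_gy, ne_one_pow_mul_pow, if_false, sq_eq_one_pow_mul_pow,
      map_mul (homologyRep F), Module.End.mul_apply, apply_homologyRep_gx_pow hTx, hTy,
      LinearEquiv.apply_symm_apply]
    fin_cases i <;> fin_cases j <;> simp [linX_apply, linY_apply]

end Traces

lemma companion_eq {F : Type} [Field F] : (0 : F) ^ 2 + 0 + 1 + (-1) * 1 = 0 := by ring

lemma sum_diag_companion {F : Type} [Field F] {T : Homology F ≃ₗ[F] (Fin 5 → F)}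
    (hTx : ∀ v, T (homologyRep F (gx : TetGroup) v) = linX companion_eq (T v))
    (hTy : ∀ v, T (homologyRep F (gy : TetGroup) v) = linY F (T v))
    (e : TetGroup ≃* A4) (g : TetGroup) :
    T (homologyRep F g (T.symm (Pi.single 0 1))) 0 +
      T (homologyRep F g (T.symm (Pi.single 1 1))) 1 = if e g ^ 2 = 1 then 2 else -1 := by
  simp only [map_sq_eq_one_iff e tetGroupEquiv]
  rcases tetGroup_normalForm g with ⟨i, rfl⟩ | ⟨i, j, rfl⟩
  · simp only [map_pow tetGroupEquiv, tetGroupEquiv_gx, sq_eq_one_pow,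
      apply_homologyRep_gx_pow hTx, LinearEquiv.apply_symm_apply]
    fin_cases i <;> simp [linX_apply] ; norm_num
  · simp only [map_mul tetGroupEquiv, map_pow tetGroupEquiv, tetGroupEquiv_gx,
      tetGroupEquiv_gy, sq_eq_one_pow_mul_pow,
      map_mul (homologyRep F), Module.End.mul_apply, apply_homologyRep_gx_pow hTx, hTy,
      LinearEquiv.apply_symm_apply]
    fin_cases i <;> fin_cases j <;> simp [linX_apply, linY_apply] <;> norm_num

lemma exists_coordinates_companion {F : Type} [Field F] (h2 : (2 : F) ≠ 0) :
    ∃ T : Homology F ≃ₗ[F] (Fin 5 → F),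
      (∀ v, T (homologyRep F (gx : TetGroup) v) = linX companion_eq (T v)) ∧
      ∀ v, T (homologyRep F (gy : TetGroup) v) = linY F (T v) :=
  -- The first basis vector is cyclic for the companion matrix, with determinant 1, over every
  -- field.
  exists_coordinates h2 companion_eq ![1, 0] (by simp)

lemma trace_eq_sum_diag {F V κ : Type*} [Field F] [AddCommGroup V] [Module F V] [Fintype κ]
    [DecidableEq κ] (T : V ≃ₗ[F] (κ → F)) (f : V →ₗ[F] V) :
    LinearMap.trace F V f = ∑ k, T (f (T.symm (Pi.single k 1))) k := by
  rw [← LinearMap.trace_conj' _ T, LinearMap.trace_eq_matrix_trace F (Pi.basisFun F κ),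
    Matrix.trace]
  refine Finset.sum_congr rfl fun k _ => ?_
  rw [Matrix.diag_apply, LinearMap.toMatrix_apply, Pi.basisFun_repr, Pi.basisFun_apply,
    LinearEquiv.conj_apply_apply]

lemma finrank_homology {F : Type} [Field F] (h2 : (2 : F) ≠ 0) :
    Module.finrank F (Homology F) = 5 := by
  obtain ⟨T, -, -⟩ := exists_coordinates_companion h2
  rw [T.finrank_eq, Module.finrank_fin_fun]

/-- Companion coordinates suffice even when ω lies in F: the plane contributes χ₂ + χ₃, whose values
are 2 and −1. -/
lemma character_homology {F : Type} [Field F] (h2 : (2 : F) ≠ 0) {ω : F}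
    (hω : IsPrimitiveRoot ω 3) (e : TetGroup ≃* A4) (g : TetGroup) :
    (homologyRep F).character g = chi2 ω (e g) + chi3 ω (e g) + chi4 F (e g) := by
  obtain ⟨T, hTx, hTy⟩ := exists_coordinates_companion h2
  rw [chi2_add_chi3 (one_add_add_sq_eq_zero hω), ← sum_diag_companion hTx hTy,
    ← sum_diag_eq_chi4 hTx hTy, Representation.character, trace_eq_sum_diag T,
    Fin.sum_univ_five]
  ring

/-! ### The decomposition of the homology modulo `p` -/

section Split

variable {F : Type} [Field F]

lemma diag_eq {ζ : F} (hζ : IsPrimitiveRoot ζ 3) : ζ ^ 2 + ζ + 1 + 0 * 0 = 0 := by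
  linear_combination one_add_add_sq_eq_zero hζ

/-- The blocks of the coordinates if `F` has a primitive cube root of unity. -/
def splitBlock : Fin 5 → Fin 3 := ![0, 1, 2, 2, 2]

/-- The blocks of the coordinates if `F` has no primitive cube root of unity. -/
def nonsplitBlock : Fin 5 → Fin 2 := ![0, 0, 1, 1, 1]

lemma splitBlock_surjective : Function.Surjective splitBlock := by decide

lemma nonsplitBlock_surjective : Function.Surjective nonsplitBlock := by decide

lemma exists_coordinates_split (h2 : (2 : F) ≠ 0) {ζ : F} (hζ : IsPrimitiveRoot ζ 3) :
    ∃ T : Homology F ≃ₗ[F] (Fin 5 → F),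
      (∀ v, T (homologyRep F (gx : TetGroup) v) = linX (diag_eq hζ) (T v)) ∧
      ∀ v, T (homologyRep F (gy : TetGroup) v) = linY F (T v) := by
  -- For a diagonal matrix with distinct eigenvalues, a vector with both entries non-zero is cyclic.
  refine exists_coordinates h2 (diag_eq hζ) ![1, 1] ?_
  simp only [Matrix.cons_val_zero, Matrix.cons_val_one]
  intro h
  have h1 := one_add_add_sq_eq_zero hζ
  have h3 : ζ * (ζ - 1) = 0 := by linear_combination h1 + h
  rcases mul_eq_zero.mp h3 with h | h
  · exact hζ.ne_zero (by norm_num) h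
  · exact hζ.ne_one (by norm_num) (sub_eq_zero.mp h)

lemma isStable_map {a b c : F} {h : a ^ 2 + a + 1 + b * c = 0}
    {T : Homology F ≃ₗ[F] (Fin 5 → F)}
    (hTx : ∀ v, T (homologyRep F (gx : TetGroup) v) = linX h (T v))
    (hTy : ∀ v, T (homologyRep F (gy : TetGroup) v) = linY F (T v))
    {W : Submodule F (Homology F)} (hW : ∀ g, ∀ w ∈ W, homologyRep F g w ∈ W) :
    IsStable h (W.map (T : Homology F →ₗ[F] (Fin 5 → F))) := by
  constructor
  · rintro _ ⟨w, hw, rfl⟩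
    exact ⟨_, hW _ w hw, hTx w⟩
  · rintro _ ⟨w, hw, rfl⟩
    exact ⟨_, hW _ w hw, hTy w⟩

lemma symm_mem_of_mem_map {T : Homology F ≃ₗ[F] (Fin 5 → F)} {W : Submodule F (Homology F)}
    {v : Fin 5 → F} (hv : v ∈ W.map (T : Homology F →ₗ[F] (Fin 5 → F))) : T.symm v ∈ W := by
  obtain ⟨w, hw, rfl⟩ := hv
  simpa using hw

variable (h2 : (2 : F) ≠ 0) {ζ : F} (hζ : IsPrimitiveRoot ζ 3)
  {T : Homology F ≃ₗ[F] (Fin 5 → F)}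

section

variable (hTx : ∀ v, T (homologyRep F (gx : TetGroup) v) = linX (diag_eq hζ) (T v))
  (hTy : ∀ v, T (homologyRep F (gy : TetGroup) v) = linY F (T v))

include h2 hTx hTy

/-- On the plane, x has the distinct eigenvalues ζ and −1 − ζ = ζ². Applying x − ζ² or ζ − x to the
plane part of a vector isolates one eigenline; the monomial block is covered by
`IsStable.single_mem`. -/
lemma hasSimpleBlocks_split : HasSimpleBlocks (homologyRep F) T splitBlock := by
  intro W hW w hw k hk k' hk'
  have hU := isStable_map hTx hTy hW
  have hwU := Submodule.mem_map_of_mem (f := (T : Homology F →ₗ[F] (Fin 5 → F))) hw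
  apply symm_mem_of_mem_map
  have hne : ζ - (-1 - ζ) ≠ 0 := fun h => by
    have h1 := one_add_add_sq_eq_zero hζ
    have h3 : ζ ^ 3 = 1 := hζ.pow_eq_one
    have h4 : ζ ^ 2 = ζ := by linear_combination h1 - h
    have h5 : ζ = 1 := by
      have : ζ ^ 3 = ζ := by linear_combination (ζ + 1) * h4
      rw [← this, h3]
    exact hζ.ne_one (by norm_num) h5
  have h1 := hU.proj_mem h2 hwU
  have h3 := hU.1 _ h1
  rcases (by decide : ∀ k k' : Fin 5, splitBlock k' = splitBlock k →
    (k = 0 ∧ k' = 0) ∨ (k = 1 ∧ k' = 1) ∨ (2 ≤ k ∧ 2 ≤ k')) k k' hk' with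
    ⟨rfl, rfl⟩ | ⟨rfl, rfl⟩ | ⟨h, h'⟩
  · have hk0 : T w 0 ≠ 0 := hk
    have h4 := Submodule.smul_mem _ ((ζ - (-1 - ζ)) * T w 0)⁻¹
      (sub_mem h3 (Submodule.smul_mem _ (-1 - ζ) h1))
    convert h4 using 1
    ext k; fin_cases k <;> simp [linX_apply]
    rw [← sub_mul]
    field_simp
  · have hk0 : T w 1 ≠ 0 := hk
    have h4 := Submodule.smul_mem _ ((ζ - (-1 - ζ)) * T w 1)⁻¹
      (sub_mem (Submodule.smul_mem _ ζ h1) h3)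
    convert h4 using 1
    ext k; fin_cases k <;> simp [linX_apply]
    rw [← sub_mul]
    field_simp
  · exact hU.single_mem h2 hwU h hk h'

omit h2 in
lemma stable_blockSum_split (g : TetGroup) (S : Finset (Fin 3)) :
    ∀ v ∈ blockSum T splitBlock S, homologyRep F g v ∈ blockSum T splitBlock S := by
  refine stable_of_stable_gens ?_ ?_ g
  · intro w hw k hk
    rw [hTx, linX_apply]
    have h0 := hw 0
    have h1 := hw 1
    have h2 := hw 2
    have h3 := hw 3
    have h4 := hw 4
    fin_cases k <;> simp_all [splitBlock]
  · intro w hw k hk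
    have := hw k hk
    rw [hTy, linY_apply]
    fin_cases k <;> simpa using this

omit h2 in
lemma apply_homologyRep_split (g : TetGroup) (v : Homology F) :
    T (homologyRep F g v) 0 = linChar (hζ.isUnit (by norm_num)).unit
      (Units.ext (by simpa using hζ.pow_eq_one)) g * T v 0 ∧
    T (homologyRep F g v) 1 = linChar (hζ.isUnit (by norm_num)).unit
      (Units.ext (by simpa using hζ.pow_eq_one)) g ^ 2 * T v 1 := by
  induction g using tetGroup_induction with
  | one => simp
  | hx g ih =>
    rw [map_mul, Module.End.mul_apply, hTx, linX_apply]
    simp [ih.1, ih.2, mul_assoc]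
    linear_combination (-linChar (hζ.isUnit (by norm_num)).unit
      (Units.ext (by simpa using hζ.pow_eq_one)) g ^ 2 * T v 1) * one_add_add_sq_eq_zero hζ
  | hy g ih =>
    rw [map_mul, Module.End.mul_apply, hTy, linY_apply]
    simp [ih.1, ih.2]

end

section

variable (hTx : ∀ v, T (homologyRep F (gx : TetGroup) v) = linX companion_eq (T v))
  (hTy : ∀ v, T (homologyRep F (gy : TetGroup) v) = linY F (T v))

include h2 hTx hTy

/-- The determinant of the plane parts of u and xu is the form u² − uv + v² in the two coordinates.
It is anisotropic because `r ^ 2 + r + 1` has no root, so every non-zero vector of the plane is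
cyclic. -/
lemma hasSimpleBlocks_nonsplit (hF : ∀ r : F, r ^ 2 + r + 1 ≠ 0) :
    HasSimpleBlocks (homologyRep F) T nonsplitBlock := by
  intro W hW w hw k hk k' hk'
  have hU := isStable_map hTx hTy hW
  have hwU := Submodule.mem_map_of_mem (f := (T : Homology F →ₗ[F] (Fin 5 → F))) hw
  apply symm_mem_of_mem_map
  rcases (by decide : ∀ k k' : Fin 5, nonsplitBlock k' = nonsplitBlock k →
    ((k = 0 ∨ k = 1) ∧ k' < 2) ∨ (2 ≤ k ∧ 2 ≤ k')) k k' hk' with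
    ⟨h, h'⟩ | ⟨h, h'⟩
  · refine hU.single_mem_of_cyclic h2 hwU ?_ h'
    simp only [LinearEquiv.coe_coe]
    set u := T w 0
    set v := T w 1
    intro h0
    have h1 : u ^ 2 - u * v + v ^ 2 = 0 := by linear_combination h0
    by_cases hv : v = 0
    · have hu : u = 0 := by simpa [hv] using h1
      rcases h with rfl | rfl
      · exact hk hu
      · exact hk hv
    · refine hF (-u / v) ?_
      field_simp
      linear_combination h1
  · exact hU.single_mem h2 hwU h hk h'

omit h2 in
lemma stable_blockSum_nonsplit (g : TetGroup) (S : Finset (Fin 2)) :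
    ∀ v ∈ blockSum T nonsplitBlock S, homologyRep F g v ∈ blockSum T nonsplitBlock S := by
  refine stable_of_stable_gens ?_ ?_ g
  · intro w hw k hk
    rw [hTx, linX_apply]
    have h0 := hw 0
    have h1 := hw 1
    have h2 := hw 2
    have h3 := hw 3
    have h4 := hw 4
    fin_cases k <;> simp_all [nonsplitBlock]
  · intro w hw k hk
    have := hw k hk
    rw [hTy, linY_apply]
    fin_cases k <;> simpa using this

end

end Split

lemma character_blockRep {F G V κ ι : Type*} [Field F] [Group G] [AddCommGroup V] [Module F V]
    [Fintype κ] [DecidableEq κ] [Fintype ι] [DecidableEq ι] {ρ : Representation F G V}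
    {T : V ≃ₗ[F] (κ → F)} {ℓ : κ → ι}
    (hT : ∀ g S, ∀ v ∈ blockSum T ℓ S, ρ g v ∈ blockSum T ℓ S) (i : ι) (g : G) :
    (blockRep hT i).toRepresentation.character g =
      ∑ k : κ with ℓ k = i, T (ρ g (T.symm (Pi.single k 1))) k := by
  refine (trace_restrict_blockSum T ℓ {i} (ρ g) (hT g {i})).trans ?_
  simp only [Finset.mem_singleton]

/-- If `F` has a primitive cube root of unity, the homology is the direct sum of three irreducible
submodules with characters `χ₂`, `χ₃` and `χ₄`. -/
theorem homology_decomposition_split {F : Type} [Field F] (h2 : (2 : F) ≠ 0) {ζ : F}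
    (hζ : IsPrimitiveRoot ζ 3) (e : TetGroup ≃* A4) :
    ∃ (ω : F) (A : Fin 3 → Subrepresentation (homologyRep F)),
      IsPrimitiveRoot ω 3 ∧
      DirectSum.IsInternal (fun i => (A i).toSubmodule) ∧
      (∀ i, (A i).toRepresentation.IsIrreducible) ∧
      (∀ i, Module.finrank F (A i).toSubmodule = ![1, 1, 3] i) ∧
      (∀ g, (A 0).toRepresentation.character g = chi2 ω (e g)) ∧
      (∀ g, (A 1).toRepresentation.character g = chi3 ω (e g)) ∧
      (∀ g, (A 2).toRepresentation.character g = chi4 F (e g)) := by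
  obtain ⟨T, hTx, hTy⟩ := exists_coordinates_split h2 hζ
  have hT := stable_blockSum_split hζ hTx hTy
  have hchar := apply_homologyRep_split hζ hTx hTy
  set χ := linChar (hζ.isUnit (by norm_num)).unit (Units.ext (by simpa using hζ.pow_eq_one))
    with hχ
  obtain ⟨ω, hω, hω2, hω3⟩ := exists_eq_chi2 χ (linChar_pow_three _ _)
    (by simpa [hχ] using hζ.ne_one (by norm_num)) e
  refine ⟨ω, blockRep hT, hω, isInternal_blockSum T splitBlock,
    (hasSimpleBlocks_split h2 hζ hTx hTy).isIrreducible splitBlock_surjective hT, fun i => ?_,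
    fun g => ?_, fun g => ?_, fun g => ?_⟩
  · refine (finrank_blockSum T splitBlock {i}).trans ?_
    revert i; decide
  · rw [character_blockRep, (by decide : (Finset.univ.filter fun k => splitBlock k = 0) = {0}),
      Finset.sum_singleton, (hchar g _).1]
    simp [hω2]
  · rw [character_blockRep, (by decide : (Finset.univ.filter fun k => splitBlock k = 1) = {1}),
      Finset.sum_singleton, (hchar g _).2]
    simp [hω3]
  · rw [character_blockRep,
      (by decide : (Finset.univ.filter fun k => splitBlock k = 2) = {2, 3, 4}),
      ← sum_diag_eq_chi4 hTx hTy]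
    simp [add_assoc]

/-- If `F` has no primitive cube root of unity, the homology is the direct sum of two irreducible
submodules with characters `χ₂ + χ₃` and `χ₄`. -/
theorem homology_decomposition_nonsplit {F : Type} [Field F] (h2 : (2 : F) ≠ 0)
    (hF : ∀ r : F, r ^ 2 + r + 1 ≠ 0) (e : TetGroup ≃* A4) :
    ∃ A : Fin 2 → Subrepresentation (homologyRep F),
      DirectSum.IsInternal (fun i => (A i).toSubmodule) ∧
      (∀ i, (A i).toRepresentation.IsIrreducible) ∧
      (∀ i, Module.finrank F (A i).toSubmodule = ![2, 3] i) ∧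
      (∀ ω : AlgebraicClosure F, IsPrimitiveRoot ω 3 →
        ∀ g, algebraMap F (AlgebraicClosure F) ((A 0).toRepresentation.character g) =
          chi2 ω (e g) + chi3 ω (e g)) ∧
      (∀ g, (A 1).toRepresentation.character g = chi4 F (e g)) := by
  obtain ⟨T, hTx, hTy⟩ := exists_coordinates_companion h2
  have hT := stable_blockSum_nonsplit hTx hTy
  refine ⟨blockRep hT, isInternal_blockSum T nonsplitBlock,
    (hasSimpleBlocks_nonsplit h2 hTx hTy hF).isIrreducible nonsplitBlock_surjective hT,
    fun i => ?_, fun ω hω g => ?_, fun g => ?_⟩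
  · refine (finrank_blockSum T nonsplitBlock {i}).trans ?_
    revert i; decide
  · rw [chi2_add_chi3 (one_add_add_sq_eq_zero hω), character_blockRep,
      (by decide : (Finset.univ.filter fun k => nonsplitBlock k = 0) = {0, 1}),
      Finset.sum_pair (by decide), sum_diag_companion hTx hTy e]
    split_ifs
    · exact map_ofNat _ 2
    · rw [map_neg, map_one]
  · rw [character_blockRep,
      (by decide : (Finset.univ.filter fun k => nonsplitBlock k = 1) = {2, 3, 4}),
      ← sum_diag_eq_chi4 hTx hTy]
    simp [add_assoc]

/-! ### Monodromy of hypermaps -/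

namespace Hypermap

/-- A hypermap with `x ^ 3 = z ^ 3 = 1`. -/
def IsCubic (H : Hypermap) : Prop := H.x ^ 3 = 1 ∧ H.z ^ 3 = 1

/-- The action of `Δ(3, ∞, 3)` on the darts. -/
def monodromy {H : Hypermap} (hH : H.IsCubic) : EdgeTriangleGroup →* Equiv.Perm H.Dart :=
  deltaLift H.x H.y hH.1 (by
    have := hH.2
    rwa [z, inv_pow, inv_eq_one] at this)

section monodromy

variable {H K : Hypermap} (hH : H.IsCubic) (hK : K.IsCubic)

@[simp] lemma monodromy_gx : monodromy hH gx = H.x := deltaLift_gx ..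

@[simp] lemma monodromy_gy : monodromy hH gy = H.y := deltaLift_gy ..

@[simp] lemma monodromy_gz : monodromy hH gz = H.z := by
  rw [gz_eq, map_inv, map_mul, monodromy_gx, monodromy_gy, z]

lemma exists_monodromy_eq (d d' : H.Dart) : ∃ g, monodromy hH g d = d' := by
  obtain ⟨w, hw, h⟩ := H.connected d d'
  have hle : Subgroup.closure {H.x, H.y} ≤ (monodromy hH).range := by
    rw [Subgroup.closure_le]
    rintro _ (rfl | rfl)
    · exact ⟨gx, monodromy_gx hH⟩
    · exact ⟨gy, monodromy_gy hH⟩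
  obtain ⟨g, rfl⟩ := hle hw
  exact ⟨g, h⟩

/-- Maps which commute with the generators commute with the monodromy. -/
lemma map_monodromy {f : H.Dart → K.Dart} (hx : ∀ d, f (H.x d) = K.x (f d))
    (hy : ∀ d, f (H.y d) = K.y (f d)) (g : EdgeTriangleGroup) (d : H.Dart) :
    f (monodromy hH g d) = monodromy hK g (f d) := by
  have hg : g ∈ Subgroup.closure {gx, gy} := by rw [closure_gx_gy]; trivial
  induction hg using Subgroup.closure_induction generalizing d with
  | mem g hg =>
    rcases hg with rfl | rfl
    · simpa using hx d
    · simpa using hy d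
  | one => simp
  | mul a b _ _ iha ihb => simp [iha, ihb]
  | inv a _ ih =>
    rw [map_inv, map_inv, Equiv.Perm.eq_inv_iff_eq, ← ih, ← Equiv.Perm.mul_apply, mul_inv_cancel,
      Equiv.Perm.one_apply]

lemma mem_autPlus_iff {σ : Equiv.Perm H.Dart} :
    σ ∈ H.autPlus ↔ (∀ d, σ (H.x d) = H.x (σ d)) ∧ ∀ d, σ (H.y d) = H.y (σ d) := by
  rw [autPlus, Subgroup.mem_centralizer_iff]
  simp only [Set.mem_insert_iff, Set.mem_singleton_iff, forall_eq_or_imp, forall_eq]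
  simp only [Equiv.ext_iff, Equiv.Perm.mul_apply, eq_comm]

lemma autPlus_monodromy {σ : Equiv.Perm H.Dart} (hσ : σ ∈ H.autPlus) (g : EdgeTriangleGroup)
    (d : H.Dart) : σ (monodromy hH g d) = monodromy hH g (σ d) :=
  map_monodromy hH hH (mem_autPlus_iff.mp hσ).1 (mem_autPlus_iff.mp hσ).2 g d

include hH in
lemma autPlus_ext {σ τ : Equiv.Perm H.Dart} (hσ : σ ∈ H.autPlus) (hτ : τ ∈ H.autPlus)
    {d : H.Dart} (h : σ d = τ d) : σ = τ := by
  ext d'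
  obtain ⟨g, rfl⟩ := exists_monodromy_eq hH d d'
  rw [autPlus_monodromy hH hσ, autPlus_monodromy hH hτ, h]

/-- Automorphisms commute with the monodromy and are transitive, so an element fixing one dart fixes
all of them. -/
lemma IsOrientablyRegular.monodromy_eq_one (hreg : H.IsOrientablyRegular) {g : EdgeTriangleGroup}
    {d : H.Dart} (h : monodromy hH g d = d) : monodromy hH g = 1 := by
  ext d'
  obtain ⟨σ, hσ, rfl⟩ := hreg d d'
  rw [← autPlus_monodromy hH hσ, h, Equiv.Perm.one_apply]

/-- Isomorphic hypermaps have the same monodromy kernel. -/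
lemma Iso.ker_monodromy (f : Iso H K) : (monodromy hH).ker = (monodromy hK).ker := by
  ext g
  simp only [MonoidHom.mem_ker, Equiv.ext_iff, Equiv.Perm.one_apply]
  have h := map_monodromy hH hK f.map_x f.map_y g
  constructor
  · intro h1 d
    obtain ⟨e, rfl⟩ := f.toEquiv.surjective d
    exact (h e).symm.trans (congrArg _ (h1 e))
  · intro h1 d
    exact f.toEquiv.injective ((h d).trans (h1 _))

end monodromy

lemma tetrahedron_isCubic : tetrahedron.IsCubic :=
  ⟨(by decide : tetX ^ 3 = 1), (by decide : ((tetX * tetY)⁻¹) ^ 3 = 1)⟩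

lemma monodromy_tetrahedron : monodromy tetrahedron_isCubic = tetMonodromy :=
  delta_hom_ext (by rw [monodromy_gx, tetMonodromy_gx]; rfl)
    (by rw [monodromy_gy, tetMonodromy_gy]; rfl)

lemma monodromy_tetrahedron_eq_one_iff {g : EdgeTriangleGroup} :
    monodromy tetrahedron_isCubic g = 1 ↔ g ∈ edgePuncturedPi := by
  rw [monodromy_tetrahedron, ← ker_tetMonodromy, MonoidHom.mem_ker]

/-- G acts freely on the darts of the tetrahedron: of the twelve normal forms only 1 fixes a dart.
Membership in M can therefore be tested at a single dart. -/
lemma mem_edgePuncturedPi_iff {g : EdgeTriangleGroup} (d : tetrahedron.Dart) :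
    g ∈ edgePuncturedPi ↔ monodromy tetrahedron_isCubic g d = d := by
  refine ⟨fun h => by rw [monodromy_tetrahedron_eq_one_iff.mpr h]; rfl, fun h => ?_⟩
  rw [monodromy_tetrahedron] at h
  have hf : ∀ k : EdgeTriangleGroup, (g : TetGroup) = k → tetMonodromy k d = d := fun k hk => by
    have h1 := QuotientGroup.eq.mp hk.symm
    rw [← ker_tetMonodromy, MonoidHom.mem_ker, map_mul, map_inv, inv_mul_eq_one] at h1
    rw [h1, h]
  rcases tetGroup_normalForm g with ⟨i, hi⟩ | ⟨i, j, hij⟩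
  · have h1 := hf (gx ^ (i : ℕ)) hi
    rw [map_pow, tetMonodromy_gx] at h1
    have := (by decide : ∀ (i : Fin 3) (d : TetDart), (tetX ^ (i : ℕ)) d = d → i = 0) i d h1
    subst this
    rw [← tetGroup_mk_eq_one, hi]; simp
  · have h1 := hf (gx ^ (i : ℕ) * gy * gx ^ (j : ℕ)) hij
    rw [map_mul, map_mul, map_pow, map_pow, tetMonodromy_gx, tetMonodromy_gy] at h1
    exact absurd h1 ((by decide : ∀ (i j : Fin 3) (d : TetDart),
      (tetX ^ (i : ℕ) * tetY * tetX ^ (j : ℕ)) d ≠ d) i j d)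

/-! ### Coverings of the tetrahedron -/

section Covering

variable {H : Hypermap} (hH : H.IsCubic) (hreg : H.IsOrientablyRegular)
  (ψ : Covering H tetrahedron)

include ψ in
lemma ker_monodromy_le : (monodromy hH).ker ≤ edgePuncturedPi := by
  intro g hg
  obtain ⟨d⟩ := H.nonempty
  rw [mem_edgePuncturedPi_iff (ψ.toFun d), ← map_monodromy hH tetrahedron_isCubic ψ.map_x ψ.map_y,
    MonoidHom.mem_ker.mp hg, Equiv.Perm.one_apply]

include hH in
lemma mem_deckGroup {σ : Equiv.Perm H.Dart} (hσ : σ ∈ H.autPlus) {d : H.Dart}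
    (h : ψ.toFun (σ d) = ψ.toFun d) : σ ∈ ψ.deckGroup := by
  refine ⟨hσ, fun d' => ?_⟩
  obtain ⟨g, rfl⟩ := exists_monodromy_eq hH d d'
  rw [autPlus_monodromy hH hσ, map_monodromy hH tetrahedron_isCubic ψ.map_x ψ.map_y, h,
    ← map_monodromy hH tetrahedron_isCubic ψ.map_x ψ.map_y]

include hreg in
/-- The covering group is a quotient of the fundamental group. -/
lemma exists_deckHom : ∃ f : edgePuncturedPi →* (ψ.deckGroup)ᵐᵒᵖ, Function.Surjective f ∧
    ∀ m, f m = 1 ↔ monodromy hH m = 1 := by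
  obtain ⟨d⟩ := H.nonempty
  have key : ∀ m : edgePuncturedPi, ∃ σ : ψ.deckGroup, σ.1 d = monodromy hH m d := fun m => by
    obtain ⟨σ, hσ, h⟩ := hreg d (monodromy hH m d)
    refine ⟨⟨σ, mem_deckGroup hH ψ hσ (d := d) ?_⟩, h⟩
    rw [h, map_monodromy hH tetrahedron_isCubic ψ.map_x ψ.map_y,
      (mem_edgePuncturedPi_iff (ψ.toFun d)).mp m.2]
  choose s hs using key
  have hext : ∀ σ τ : ψ.deckGroup, σ.1 d = τ.1 d → σ = τ := fun σ τ h =>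
    Subtype.ext (autPlus_ext hH σ.2.1 τ.2.1 h)
  -- `s m` is the deck transformation moving `d` as `m` does. Deck transformations commute with the
  -- monodromy, so `s` reverses products; hence the opposite group.
  refine ⟨MonoidHom.mk' (fun m => MulOpposite.op (s m)) fun m n => ?_, fun σ => ?_, fun m => ?_⟩
  · rw [← MulOpposite.op_mul]
    refine congrArg _ (hext _ _ ?_)
    rw [hs, Subgroup.coe_mul, map_mul, Equiv.Perm.mul_apply, Subgroup.coe_mul,
      Equiv.Perm.mul_apply, hs, ← hs n, autPlus_monodromy hH (s n).2.1, hs]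
  · obtain ⟨g, hg⟩ := exists_monodromy_eq hH d (σ.unop.1 d)
    have hgM : g ∈ edgePuncturedPi := by
      rw [mem_edgePuncturedPi_iff (ψ.toFun d),
        ← map_monodromy hH tetrahedron_isCubic ψ.map_x ψ.map_y, hg, σ.unop.2.2]
    refine ⟨⟨g, hgM⟩, MulOpposite.unop_injective (hext _ _ ?_)⟩
    exact (hs _).trans hg
  · constructor
    · intro h
      have h1 : s m = 1 := MulOpposite.op_injective h
      refine hreg.monodromy_eq_one hH (d := d) ?_
      rw [← hs, h1]; rfl
    · intro h
      refine congrArg MulOpposite.op (hext (s m) 1 ?_)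
      rw [hs, h]; rfl

include hreg in
/-- An orientably regular covering of the tetrahedron whose group is isomorphic to an elementary
abelian quotient of the fundamental group. -/
lemma isElementaryAbelian_of_hom {A : Type*} [CommGroup A] {p c : ℕ} (hc : 1 ≤ c)
    (hp : ∀ a : A, a ^ p = 1) (hcard : Nat.card A = p ^ c) (f : edgePuncturedPi →* A)
    (hf : Function.Surjective f) (hker : ∀ m, f m = 1 ↔ monodromy hH m = 1) :
    ψ.IsElementaryAbelian p c := by
  obtain ⟨q, hq, hqker⟩ := exists_deckHom hH hreg ψ
  have hkk : f.ker = q.ker := by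
    ext m
    rw [MonoidHom.mem_ker, MonoidHom.mem_ker, hker, hqker]
  let e : A ≃* (ψ.deckGroup)ᵐᵒᵖ := (QuotientGroup.quotientKerEquivOfSurjective f hf).symm.trans
    ((QuotientGroup.quotientMulEquivOfEq hkk).trans
      (QuotientGroup.quotientKerEquivOfSurjective q hq))
  have he : ∀ σ (hσ : σ ∈ ψ.deckGroup), ∃ a, σ = (e a).unop.1 := fun σ hσ =>
    ⟨e.symm (MulOpposite.op ⟨σ, hσ⟩), by rw [e.apply_symm_apply]; rfl⟩
  -- The period divides 3, and it is not 1 because an element outside M moves the dart below.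
  have hfix : ∀ g : EdgeTriangleGroup, g ∉ edgePuncturedPi → g ^ 3 = 1 → ∀ d : H.Dart,
      Function.minimalPeriod (monodromy hH g) d = 3 := fun g hg h3 d => by
    refine Function.minimalPeriod_eq_prime (p := 3) ?_ fun h => hg ?_
    · rw [Function.IsPeriodicPt, Equiv.Perm.iterate_eq_pow, ← map_pow, h3, map_one]
      rfl
    · rw [mem_edgePuncturedPi_iff (ψ.toFun d),
        ← map_monodromy hH tetrahedron_isCubic ψ.map_x ψ.map_y, h.eq]
  have hbr : ∀ g : EdgeTriangleGroup, g ∉ edgePuncturedPi → g ^ 3 = 1 → ∀ d : H.Dart,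
      Function.minimalPeriod (monodromy hH g) d =
        Function.minimalPeriod (monodromy tetrahedron_isCubic g) (ψ.toFun d) :=
    fun g hg h3 d => by
      rw [hfix g hg h3, Function.minimalPeriod_eq_prime (p := 3)]
      · rw [Function.IsPeriodicPt, Equiv.Perm.iterate_eq_pow, ← map_pow, h3, map_one]
        rfl
      · exact fun h => hg ((mem_edgePuncturedPi_iff _).mpr h.eq)
  have hx : gx ∉ edgePuncturedPi := by
    rw [← monodromy_tetrahedron_eq_one_iff, monodromy_gx]
    exact (by decide : tetX ≠ 1)
  have hz : gz ∉ edgePuncturedPi := by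
    rw [← monodromy_tetrahedron_eq_one_iff, monodromy_gz]
    exact (by decide : (tetX * tetY)⁻¹ ≠ 1)
  refine ⟨hc, hreg, fun d d' h => ?_, fun d => ⟨?_, ?_⟩, fun σ hσ τ hτ => ?_, fun σ hσ => ?_, ?_⟩
  · obtain ⟨σ, hσ, rfl⟩ := hreg d d'
    exact ⟨σ, mem_deckGroup hH ψ hσ h.symm, rfl⟩
  · have := hbr gx hx gx_pow_three d
    rwa [monodromy_gx, monodromy_gx] at this
  · have := hbr gz hz gz_pow_three d
    rwa [monodromy_gz, monodromy_gz] at this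
  · obtain ⟨a, rfl⟩ := he σ hσ
    obtain ⟨b, rfl⟩ := he τ hτ
    rw [← Subgroup.coe_mul, ← MulOpposite.unop_mul, ← map_mul, mul_comm, map_mul]
    rfl
  · obtain ⟨a, rfl⟩ := he σ hσ
    rw [← Subgroup.coe_pow, ← MulOpposite.unop_pow, ← map_pow, hp, map_one]
    rfl
  · rw [← hcard, Nat.card_congr e.toEquiv, Nat.card_congr MulOpposite.opEquiv]

end Covering

end Hypermap

namespace Hypermap

/-! ### Type and genus -/

/-- By hypothesis the cyclic group generated by `f` acts freely, so all cycles have length `orderOf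
f`. -/
lemma numCycles_mul_orderOf {D : Type} [Finite D] (f : Equiv.Perm D)
    (hf : ∀ (n : ℤ) (d : D), (f ^ n) d = d → f ^ n = 1) :
    numCycles f * orderOf f = Nat.card D := by
  have hstab : ∀ d : D, MulAction.stabilizer (Subgroup.zpowers f) d = ⊥ := fun d => by
    rw [eq_bot_iff]
    rintro ⟨_, n, rfl⟩ h
    rw [Subgroup.mem_bot]
    exact Subtype.ext (hf n d h)
  have hrel : Equiv.Perm.SameCycle.setoid f = MulAction.orbitRel (Subgroup.zpowers f) D := by
    ext a b
    rw [MulAction.orbitRel_apply, MulAction.mem_orbit_iff]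
    change f.SameCycle a b ↔ _
    rw [Equiv.Perm.sameCycle_comm]
    constructor
    · rintro ⟨n, h⟩
      exact ⟨⟨f ^ n, n, rfl⟩, h⟩
    · rintro ⟨⟨_, n, rfl⟩, h⟩
      exact ⟨n, h⟩
  rw [numCycles, hrel, Nat.card_congr (MulAction.selfEquivOrbitsQuotientProd hstab),
    Nat.card_prod, Nat.card_zpowers]

section

variable {H : Hypermap} (hH : H.IsCubic) (hreg : H.IsOrientablyRegular)

include hreg in
lemma numCycles_monodromy_mul (g : EdgeTriangleGroup) :
    numCycles (monodromy hH g) * orderOf (monodromy hH g) = Nat.card H.Dart := by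
  have := H.finite
  refine numCycles_mul_orderOf _ fun n d h => ?_
  rw [← map_zpow] at h ⊢
  exact hreg.monodromy_eq_one hH h

include hreg in
lemma card_dart : Nat.card H.Dart = (monodromy hH).ker.index := by
  obtain ⟨d⟩ := H.nonempty
  refine (Nat.card_congr (Equiv.ofBijective (fun q : EdgeTriangleGroup ⧸ (monodromy hH).ker =>
    QuotientGroup.kerLift (monodromy hH) q d) ⟨?_, fun d' => ?_⟩)).symm
  · intro q q' h
    induction q using QuotientGroup.induction_on with | _ g =>
    induction q' using QuotientGroup.induction_on with | _ g' =>
    change monodromy hH g d = monodromy hH g' d at h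
    rw [QuotientGroup.eq, MonoidHom.mem_ker]
    refine hreg.monodromy_eq_one hH (d := d) ?_
    rw [map_mul, Equiv.Perm.mul_apply, ← h, map_inv, ← Equiv.Perm.mul_apply, inv_mul_cancel,
      Equiv.Perm.one_apply]
  · obtain ⟨g, hg⟩ := exists_monodromy_eq hH d d'
    exact ⟨g, hg⟩

end

section

variable {H : Hypermap} {φ : Covering H tetrahedron} {p c : ℕ}

/-- Unbranchedness over vertices and faces gives the x- and z-cycles the same lengths as those below
them, and these lengths divide 3. -/
lemma Covering.IsElementaryAbelian.isCubic (h : φ.IsElementaryAbelian p c) : H.IsCubic := by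
  obtain ⟨-, -, -, hbr, -⟩ := h
  have h3 : ∀ {D E : Type} (f : Equiv.Perm D) (g : Equiv.Perm E) (d : D) (e : E), g ^ 3 = 1 →
      Function.minimalPeriod f d = Function.minimalPeriod g e → (f ^ 3) d = d := by
    intro D E f g d e hg hfg
    rw [← Equiv.Perm.iterate_eq_pow]
    refine Function.isPeriodicPt_iff_minimalPeriod_dvd.mpr ?_
    rw [hfg, ← Function.isPeriodicPt_iff_minimalPeriod_dvd, Function.IsPeriodicPt,
      Equiv.Perm.iterate_eq_pow, hg]
    rfl
  exact ⟨Equiv.ext fun d => h3 _ _ d _ tetrahedron_isCubic.1 (hbr d).1,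
    Equiv.ext fun d => h3 _ _ d _ tetrahedron_isCubic.2 (hbr d).2⟩

lemma orderOf_monodromy_eq_three {H : Hypermap} (φ : Covering H tetrahedron) (hH : H.IsCubic)
    {g : EdgeTriangleGroup} (h3 : g ^ 3 = 1) (hg : g ∉ edgePuncturedPi) :
    orderOf (monodromy hH g) = 3 := by
  refine orderOf_eq_prime (by rw [← map_pow, h3, map_one]) fun h => hg ?_
  exact ker_monodromy_le hH φ h

lemma gx_notMem : gx ∉ edgePuncturedPi := by
  rw [← monodromy_tetrahedron_eq_one_iff, monodromy_gx]
  exact (by decide : tetX ≠ 1)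

lemma gz_notMem : gz ∉ edgePuncturedPi := by
  rw [← monodromy_tetrahedron_eq_one_iff, monodromy_gz]
  exact (by decide : (tetX * tetY)⁻¹ ≠ 1)

/-- The type and the genus of the elementary abelian coverings of the tetrahedron. -/
theorem Covering.IsElementaryAbelian.hasType_hasGenus (hp : p.Prime)
    (h : φ.IsElementaryAbelian p c) :
    H.HasType 3 (2 * p) 3 ∧ H.HasGenus (2 * (p : ℤ) ^ c - 3 * (p : ℤ) ^ (c - 1) + 1) := by
  have hH := h.isCubic
  obtain ⟨hc, hreg, -, -, -, hexp, hcard⟩ := h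
  obtain ⟨f, hf, hker⟩ := exists_deckHom hH hreg φ
  have hx : orderOf H.x = 3 := by
    rw [← monodromy_gx hH]
    exact orderOf_monodromy_eq_three φ hH gx_pow_three gx_notMem
  have hz : orderOf H.z = 3 := by
    rw [← monodromy_gz hH]
    exact orderOf_monodromy_eq_three φ hH gz_pow_three gz_notMem
  have hle := ker_monodromy_le hH φ
  have hindex : (monodromy hH).ker.relIndex edgePuncturedPi = p ^ c := by
    have h1 : (monodromy hH).ker.subgroupOf edgePuncturedPi = f.ker := by
      ext m
      rw [Subgroup.mem_subgroupOf, MonoidHom.mem_ker, MonoidHom.mem_ker, hker]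
    rw [Subgroup.relIndex, h1, Subgroup.index,
      Nat.card_congr (QuotientGroup.quotientKerEquivOfSurjective f hf).toEquiv,
      Nat.card_congr MulOpposite.opEquiv.symm, hcard]
  have hdarts : Nat.card H.Dart = p ^ c * 12 := by
    rw [card_dart hH hreg, ← Subgroup.relIndex_mul_index hle, hindex, index_edgePuncturedPi]
  have hysq : orderOf (monodromy hH (gy ^ 2)) = p := by
    have := Fact.mk hp
    refine orderOf_eq_prime ?_ fun h1 => ?_
    · rw [← map_pow]
      refine (hker (loop ^ p)).mp ?_
      rw [map_pow]
      refine MulOpposite.unop_injective (Subtype.ext ?_)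
      exact hexp _ (f loop).unop.2
    -- If y² acted trivially, the kernel would contain its normal closure M and the covering group
    -- would be trivial, against `1 ≤ c`.
    · have h2 : (monodromy hH).ker.relIndex edgePuncturedPi = 1 := by
        rw [Subgroup.relIndex_eq_one]
        refine Subgroup.normalClosure_le_normal ?_
        rintro _ rfl
        exact h1
      rw [hindex] at h2
      exact absurd h2 (Nat.one_lt_pow (by omega) hp.one_lt).ne'
  have hy : orderOf H.y = 2 * p := by
    -- The order of y is even because y has order 2 on the tetrahedron; this also covers `p = 2`.
    have h2 : 2 ∣ orderOf H.y := by
      have h3 : orderOf (monodromy tetrahedron_isCubic gy) = 2 := by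
        rw [monodromy_gy]
        exact orderOf_eq_prime (by decide : tetY ^ 2 = 1) (by decide : tetY ≠ 1)
      rw [← h3]
      apply orderOf_dvd_of_pow_eq_one
      rw [← map_pow, monodromy_tetrahedron_eq_one_iff]
      refine hle ?_
      rw [MonoidHom.mem_ker, map_pow, monodromy_gy, pow_orderOf_eq_one]
    rw [map_pow, monodromy_gy, orderOf_pow_of_dvd (by norm_num) h2] at hysq
    omega
  refine ⟨⟨hx, hy, hz⟩, ?_⟩
  have hX := numCycles_monodromy_mul hH hreg gx
  have hY := numCycles_monodromy_mul hH hreg gy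
  have hZ := numCycles_monodromy_mul hH hreg gz
  rw [monodromy_gx, hx, hdarts] at hX
  rw [monodromy_gy, hy, hdarts] at hY
  rw [monodromy_gz, hz, hdarts] at hZ
  obtain ⟨k, rfl⟩ : ∃ k, c = k + 1 := ⟨c - 1, by omega⟩
  have hY' : numCycles H.y = 6 * p ^ k := by
    refine Nat.eq_of_mul_eq_mul_right (show 0 < 2 * p by have := hp.pos; omega) ?_
    rw [hY]
    ring
  rw [HasGenus, hdarts, hY', Nat.add_sub_cancel]
  push_cast
  have hX' : (numCycles H.x : ℤ) * 3 = p ^ (k + 1) * 12 := by exact_mod_cast hX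
  have hZ' : (numCycles H.z : ℤ) * 3 = p ^ (k + 1) * 12 := by exact_mod_cast hZ
  linarith

end

/-! ### Orientably regular hypermaps from normal subgroups -/

section RegHypermap

lemma connected_quotient (N : Subgroup EdgeTriangleGroup) (d d' : EdgeTriangleGroup ⧸ N) :
    ∃ w ∈ Subgroup.closure {MulAction.toPermHom EdgeTriangleGroup (EdgeTriangleGroup ⧸ N) gx,
      MulAction.toPermHom EdgeTriangleGroup (EdgeTriangleGroup ⧸ N) gy}, w d = d' := by
  obtain ⟨g, rfl⟩ := MulAction.exists_smul_eq EdgeTriangleGroup d d'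
  refine ⟨MulAction.toPermHom _ _ g, ?_, rfl⟩
  rw [← Set.image_pair, ← MonoidHom.map_closure, closure_gx_gy]
  exact ⟨g, trivial, rfl⟩

variable (N : Subgroup EdgeTriangleGroup) [N.Normal] [N.FiniteIndex]

/-- The orientably regular hypermap with monodromy kernel `N`. -/
def regHypermap : Hypermap where
  Dart := EdgeTriangleGroup ⧸ N
  finite := inferInstance
  nonempty := ⟨1⟩
  x := MulAction.toPermHom EdgeTriangleGroup (EdgeTriangleGroup ⧸ N) gx
  y := MulAction.toPermHom EdgeTriangleGroup (EdgeTriangleGroup ⧸ N) gy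
  connected := connected_quotient N

lemma regHypermap_isCubic : (regHypermap N).IsCubic := by
  have hx : MulAction.toPermHom EdgeTriangleGroup (EdgeTriangleGroup ⧸ N) gx ^ 3 = 1 := by
    rw [← map_pow, gx_pow_three, map_one]
  have hz : (MulAction.toPermHom EdgeTriangleGroup (EdgeTriangleGroup ⧸ N) gx *
      MulAction.toPermHom EdgeTriangleGroup (EdgeTriangleGroup ⧸ N) gy)⁻¹ ^ 3 = 1 := by
    rw [← map_mul, ← map_inv, ← gz_eq, ← map_pow, gz_pow_three, map_one]
  exact ⟨hx, hz⟩

lemma monodromy_regHypermap :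
    monodromy (regHypermap_isCubic N) =
      MulAction.toPermHom EdgeTriangleGroup (EdgeTriangleGroup ⧸ N) :=
  delta_hom_ext (monodromy_gx _) (monodromy_gy _)

lemma ker_monodromy_regHypermap : (monodromy (regHypermap_isCubic N)).ker = N := by
  ext g
  have hg : monodromy (regHypermap_isCubic N) g =
      MulAction.toPermHom EdgeTriangleGroup (EdgeTriangleGroup ⧸ N) g :=
    DFunLike.congr_fun (monodromy_regHypermap N) g
  have key : MulAction.toPermHom EdgeTriangleGroup (EdgeTriangleGroup ⧸ N) g = 1 ↔ g ∈ N := by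
    rw [Equiv.ext_iff]
    constructor
    · intro h
      have h1 : ((g * 1 : EdgeTriangleGroup) : EdgeTriangleGroup ⧸ N) = 1 :=
        h (1 : EdgeTriangleGroup ⧸ N)
      rwa [mul_one, QuotientGroup.eq_one_iff] at h1
    · intro h q
      induction q using QuotientGroup.induction_on with | _ a =>
      change ((g * a : EdgeTriangleGroup) : EdgeTriangleGroup ⧸ N) = a
      rw [QuotientGroup.mk_mul, (QuotientGroup.eq_one_iff g).mpr h, one_mul]
  rw [MonoidHom.mem_ker, hg]
  exact key

lemma regHypermap_isOrientablyRegular : (regHypermap N).IsOrientablyRegular := by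
  intro d d'
  let σ : EdgeTriangleGroup ⧸ N → EdgeTriangleGroup ⧸ N → Equiv.Perm (EdgeTriangleGroup ⧸ N) :=
    -- Right multiplications commute with the left multiplications by x and y.
    fun a b => Equiv.mulRight (a⁻¹ * b)
  refine ⟨σ d d', mem_autPlus_iff.mpr ⟨fun q => ?_, fun q => ?_⟩, ?_⟩
  · exact mul_assoc (gx : EdgeTriangleGroup ⧸ N) q _
  · exact mul_assoc (gy : EdgeTriangleGroup ⧸ N) q _
  · exact mul_inv_cancel_left (G := EdgeTriangleGroup ⧸ N) d d'

variable {N}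

/-- The base dart of the tetrahedron. -/
def baseDart : tetrahedron.Dart := (⟨(0, 1), by decide⟩ : TetDart)

/-- The projection of the hypermap of a subgroup of the fundamental group. -/
def regCovering (hN : N ≤ edgePuncturedPi) : Covering (regHypermap N) tetrahedron where
  toFun q := QuotientGroup.lift N (monodromy tetrahedron_isCubic)
    (fun _ hg => monodromy_tetrahedron_eq_one_iff.mpr (hN hg)) q baseDart
  map_x q := by
    induction q using QuotientGroup.induction_on with | _ a =>
    change monodromy tetrahedron_isCubic (gx * a) baseDart =
      tetrahedron.x (monodromy tetrahedron_isCubic a baseDart)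
    rw [map_mul, monodromy_gx, Equiv.Perm.mul_apply]
  map_y q := by
    induction q using QuotientGroup.induction_on with | _ a =>
    change monodromy tetrahedron_isCubic (gy * a) baseDart =
      tetrahedron.y (monodromy tetrahedron_isCubic a baseDart)
    rw [map_mul, monodromy_gy, Equiv.Perm.mul_apply]

/-- Each orientably regular covering of the tetrahedron is isomorphic to a standard one. -/
lemma exists_iso_regHypermap {H : Hypermap} (hH : H.IsCubic) (hreg : H.IsOrientablyRegular)
    (ψ : Covering H tetrahedron) (hN : N ≤ edgePuncturedPi) (hker : (monodromy hH).ker = N) :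
    ∃ f : Iso H (regHypermap N), ∀ d, (regCovering hN).toFun (f.toFun d) = ψ.toFun d := by
  have hψ := map_monodromy hH tetrahedron_isCubic ψ.map_x ψ.map_y
  -- Choosing the origin above `baseDart` makes the isomorphism compatible with the two projections.
  obtain ⟨d, hd⟩ : ∃ d, ψ.toFun d = baseDart := by
    obtain ⟨d⟩ := H.nonempty
    obtain ⟨g, hg⟩ := exists_monodromy_eq tetrahedron_isCubic (ψ.toFun d) baseDart
    exact ⟨monodromy hH g d, by rw [hψ, hg]⟩
  let F : EdgeTriangleGroup ⧸ N → H.Dart := fun q =>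
    QuotientGroup.lift N (monodromy hH) (fun _ hg => hker.ge hg) q d
  have hF : Function.Bijective F := by
    constructor
    · intro q q' h
      induction q using QuotientGroup.induction_on with | _ g =>
      induction q' using QuotientGroup.induction_on with | _ g' =>
      change monodromy hH g d = monodromy hH g' d at h
      rw [QuotientGroup.eq, ← hker, MonoidHom.mem_ker]
      refine hreg.monodromy_eq_one hH (d := d) ?_
      rw [map_mul, Equiv.Perm.mul_apply, ← h, map_inv, ← Equiv.Perm.mul_apply, inv_mul_cancel,
        Equiv.Perm.one_apply]
    · intro d'
      obtain ⟨g, hg⟩ := exists_monodromy_eq hH d d'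
      exact ⟨g, hg⟩
  let E : (regHypermap N).Dart ≃ H.Dart := Equiv.ofBijective F hF
  have hx : ∀ q, E ((regHypermap N).x q) = H.x (E q) := fun q => by
    induction q using QuotientGroup.induction_on with | _ a =>
    change monodromy hH (gx * a) d = H.x (monodromy hH a d)
    rw [map_mul, monodromy_gx, Equiv.Perm.mul_apply]
  have hy : ∀ q, E ((regHypermap N).y q) = H.y (E q) := fun q => by
    induction q using QuotientGroup.induction_on with | _ a =>
    change monodromy hH (gy * a) d = H.y (monodromy hH a d)
    rw [map_mul, monodromy_gy, Equiv.Perm.mul_apply]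
  refine ⟨{ E.symm with map_x := fun e => ?_, map_y := fun e => ?_ }, fun e => ?_⟩
  · change E.symm (H.x e) = (regHypermap N).x (E.symm e)
    rw [Equiv.symm_apply_eq]
    exact ((hx _).trans (congrArg _ (E.apply_symm_apply e))).symm
  · change E.symm (H.y e) = (regHypermap N).y (E.symm e)
    rw [Equiv.symm_apply_eq]
    exact ((hy _).trans (congrArg _ (E.apply_symm_apply e))).symm
  · change (regCovering hN).toFun (E.symm e) = ψ.toFun e
    obtain ⟨q, rfl⟩ := E.surjective e
    rw [Equiv.symm_apply_apply]
    induction q using QuotientGroup.induction_on with | _ a =>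
    change monodromy tetrahedron_isCubic a baseDart = ψ.toFun (monodromy hH a d)
    rw [hψ, hd]

/-- The kernel does not depend on a projection, so different subgroups give hypermaps which are
non-isomorphic even when the coverings are forgotten. -/
lemma eq_of_iso_regHypermap {N' : Subgroup EdgeTriangleGroup} [N'.Normal] [N'.FiniteIndex]
    (f : Iso (regHypermap N) (regHypermap N')) : N = N' := by
  rw [← ker_monodromy_regHypermap N, ← ker_monodromy_regHypermap N']
  exact f.ker_monodromy _ _

end RegHypermap

/-! ### Mirror images -/

/-- The automorphism of `Δ(3, ∞, 3)` which corresponds to the reversal of the orientation. -/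
def reversalHom : EdgeTriangleGroup →* EdgeTriangleGroup :=
  deltaLift gx⁻¹ gy⁻¹ (by rw [inv_pow, gx_pow_three, inv_one]) (by
    have h : (gy * gx) ^ 3 = 1 := by
      have h1 : (gy * gx) ^ 3 = gx⁻¹ * (gx * gy) ^ 3 * gx := by
        simp [pow_succ, mul_assoc]
      rw [h1, gx_mul_gy_pow_three, mul_one, inv_mul_cancel]
    rw [← mul_inv_rev, inv_pow, h, inv_one])

lemma reversalHom_comp : reversalHom.comp reversalHom = MonoidHom.id _ :=
  delta_hom_ext (by simp [reversalHom]) (by simp [reversalHom])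

lemma reversalHom_reversalHom (g : EdgeTriangleGroup) : reversalHom (reversalHom g) = g :=
  DFunLike.congr_fun reversalHom_comp g

@[simp] lemma reversalHom_gx : reversalHom gx = gx⁻¹ := deltaLift_gx ..

@[simp] lemma reversalHom_gy : reversalHom gy = gy⁻¹ := deltaLift_gy ..

lemma reversalHom_mem {m : EdgeTriangleGroup} (hm : m ∈ edgePuncturedPi) :
    reversalHom m ∈ edgePuncturedPi := by
  have h := edgePuncturedPi_le_ker ((QuotientGroup.mk' edgePuncturedPi).comp reversalHom) (by
    rw [MonoidHom.comp_apply, reversalHom_gy, map_inv, inv_pow, inv_eq_one]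
    exact tetGroup_gy_sq) hm
  rwa [MonoidHom.mem_ker, MonoidHom.comp_apply, QuotientGroup.mk'_apply,
    tetGroup_mk_eq_one] at h

/-- The mirror image of a standard hypermap. -/
lemma nonempty_iso_mirror_regHypermap {N N' : Subgroup EdgeTriangleGroup} [N.Normal]
    [N.FiniteIndex] [N'.Normal] [N'.FiniteIndex] (h : N = N'.comap reversalHom) :
    Nonempty (Iso (regHypermap N).mirror (regHypermap N')) := by
  have h' : N' ≤ N.comap reversalHom := fun g hg => by
    rw [h, Subgroup.mem_comap, Subgroup.mem_comap, reversalHom_reversalHom]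
    exact hg
  have hl : ∀ q, QuotientGroup.map N' N reversalHom h'
      (QuotientGroup.map N N' reversalHom h.le q) = q := fun q => by
    induction q using QuotientGroup.induction_on with | _ a =>
    exact congrArg _ (reversalHom_reversalHom a)
  have hr : ∀ q, QuotientGroup.map N N' reversalHom h.le
      (QuotientGroup.map N' N reversalHom h' q) = q := fun q => by
    induction q using QuotientGroup.induction_on with | _ a =>
    exact congrArg _ (reversalHom_reversalHom a)
  refine ⟨{ toFun := QuotientGroup.map N N' reversalHom h.le
            invFun := QuotientGroup.map N' N reversalHom h'
            left_inv := hl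
            right_inv := hr
            map_x := fun q => ?_
            map_y := fun q => ?_ }⟩
  · change EdgeTriangleGroup ⧸ N at q
    induction q using QuotientGroup.induction_on with | _ a =>
    change ((reversalHom (gx⁻¹ * a) : EdgeTriangleGroup) : EdgeTriangleGroup ⧸ N') =
      ((gx * reversalHom a : EdgeTriangleGroup) : EdgeTriangleGroup ⧸ N')
    rw [map_mul, map_inv, reversalHom_gx, inv_inv]
  · change EdgeTriangleGroup ⧸ N at q
    induction q using QuotientGroup.induction_on with | _ a =>
    change ((reversalHom (gy⁻¹ * a) : EdgeTriangleGroup) : EdgeTriangleGroup ⧸ N') =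
      ((gy * reversalHom a : EdgeTriangleGroup) : EdgeTriangleGroup ⧸ N')
    rw [map_mul, map_inv, reversalHom_gy, inv_inv]

end Hypermap

/-! ### Stable subspaces of the homology modulo `p` and normal subgroups -/

section Subspaces

variable {p : ℕ} [Fact p.Prime]

lemma homologyClass_pow (R : Type) [CommRing R] (m : edgePuncturedPi) (n : ℕ) :
    homologyClass R (m ^ n) = n • homologyClass R m := by
  induction n with
  | zero => rw [pow_zero, homologyClass_one, zero_smul]
  | succ n ih => rw [pow_succ, homologyClass_mul, ih, add_smul, one_smul]

/-- Scalars in the prime field come from integers, and an integer multiple of a class is the class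
of a power of the loop. Every vector, not merely a spanning set, is thus represented by a loop. -/
lemma homologyClass_surjective : Function.Surjective (homologyClass (ZMod p)) := by
  intro h
  have hh : h ∈ Submodule.span (ZMod p) (Set.range (homologyClass (ZMod p))) := by
    rw [span_range_homologyClass]; trivial
  induction hh using Submodule.span_induction with
  | mem h hm => exact hm
  | zero => exact ⟨1, homologyClass_one _⟩
  | add a b _ _ iha ihb =>
    obtain ⟨m, rfl⟩ := iha
    obtain ⟨n, rfl⟩ := ihb
    exact ⟨m * n, homologyClass_mul _ m n⟩
  | smul r a _ ih =>
    obtain ⟨m, rfl⟩ := ih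
    refine ⟨m ^ r.val, ?_⟩
    rw [homologyClass_pow, ← Nat.cast_smul_eq_nsmul (ZMod p), ZMod.natCast_zmod_val]

instance : Module.Finite (ZMod p) (Homology (ZMod p)) := by
  classical
  obtain ⟨b, hb⟩ := exists_spanning_five (ZMod p)
  exact ⟨⟨Finset.univ.image b, by simpa using hb⟩⟩

instance : Finite (Homology (ZMod p)) := Module.finite_of_finite (ZMod p)

/-- The homomorphism from the fundamental group to a quotient of the homology. -/
noncomputable def quotientClass (W : Subrepresentation (homologyRep (ZMod p))) :
    edgePuncturedPi →* Multiplicative (Homology (ZMod p) ⧸ W.toSubmodule) where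
  toFun m := Multiplicative.ofAdd (W.toSubmodule.mkQ (homologyClass (ZMod p) m))
  map_one' := by rw [homologyClass_one, map_zero]; rfl
  map_mul' m n := by rw [homologyClass_mul, map_add]; rfl

lemma quotientClass_surjective (W : Subrepresentation (homologyRep (ZMod p))) :
    Function.Surjective (quotientClass W) := by
  intro q
  obtain ⟨h, hh⟩ := W.toSubmodule.mkQ_surjective q.toAdd
  obtain ⟨m, rfl⟩ := homologyClass_surjective h
  exact ⟨m, congrArg Multiplicative.ofAdd hh⟩

lemma quotientClass_eq_one_iff {W : Subrepresentation (homologyRep (ZMod p))}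
    {m : edgePuncturedPi} :
    quotientClass W m = 1 ↔ homologyClass (ZMod p) m ∈ W.toSubmodule := by
  rw [← Submodule.Quotient.mk_eq_zero]
  exact Iff.rfl

/-- The subgroup of `Δ(3, ∞, 3)` which corresponds to a stable subspace of the homology. -/
noncomputable def subgroupOfSubrep (W : Subrepresentation (homologyRep (ZMod p))) :
    Subgroup EdgeTriangleGroup :=
  (quotientClass W).ker.map edgePuncturedPi.subtype

variable (W : Subrepresentation (homologyRep (ZMod p)))

lemma subgroupOfSubrep_le : subgroupOfSubrep W ≤ edgePuncturedPi := by
  rintro _ ⟨m, -, rfl⟩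
  exact m.2

variable {W}

lemma coe_mem_subgroupOfSubrep {m : edgePuncturedPi} :
    (m : EdgeTriangleGroup) ∈ subgroupOfSubrep W ↔
      homologyClass (ZMod p) m ∈ W.toSubmodule := by
  rw [← quotientClass_eq_one_iff]
  constructor
  · rintro ⟨n, hn, hnm⟩
    rw [← Subtype.ext hnm]
    exact hn
  · intro h
    exact ⟨m, h, rfl⟩

lemma subgroupOfSubrep_injective {W' : Subrepresentation (homologyRep (ZMod p))}
    (h : subgroupOfSubrep W = subgroupOfSubrep W') : W = W' := by
  apply Subrepresentation.toSubmodule_injective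
  ext v
  obtain ⟨m, rfl⟩ := homologyClass_surjective v
  rw [← coe_mem_subgroupOfSubrep, h, coe_mem_subgroupOfSubrep]

instance : (subgroupOfSubrep W).Normal := by
  refine ⟨fun n hn g => ?_⟩
  lift n to edgePuncturedPi using subgroupOfSubrep_le W hn
  rw [← MulAut.conjNormal_apply, coe_mem_subgroupOfSubrep, ← homologyRep_homologyClass]
  exact W.apply_mem_toSubmodule _ (coe_mem_subgroupOfSubrep.mp hn)

instance : (subgroupOfSubrep W).FiniteIndex := by
  have h : (subgroupOfSubrep W).subgroupOf edgePuncturedPi = (quotientClass W).ker := by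
    ext m
    rw [Subgroup.mem_subgroupOf, coe_mem_subgroupOfSubrep, MonoidHom.mem_ker,
      quotientClass_eq_one_iff]
  refine ⟨?_⟩
  have hfin : Finite (Multiplicative (Homology (ZMod p) ⧸ W.toSubmodule)) :=
    Finite.of_surjective (fun v => Multiplicative.ofAdd (W.toSubmodule.mkQ v))
      (Multiplicative.ofAdd.surjective.comp W.toSubmodule.mkQ_surjective)
  rw [← Subgroup.relIndex_mul_index (subgroupOfSubrep_le W), Subgroup.relIndex, h,
    index_edgePuncturedPi, Subgroup.index_ker]
  exact mul_ne_zero Nat.card_pos.ne' (by norm_num)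

variable (W)

/-- The covering of the tetrahedron which corresponds to a stable subspace of the homology. -/
noncomputable def subrepCovering :
    Hypermap.Covering (Hypermap.regHypermap (subgroupOfSubrep W)) tetrahedron :=
  Hypermap.regCovering (subgroupOfSubrep_le W)

lemma subrepCovering_isElementaryAbelian {c : ℕ} (hc : 1 ≤ c)
    (hW : Module.finrank (ZMod p) (Homology (ZMod p) ⧸ W.toSubmodule) = c) :
    (subrepCovering W).IsElementaryAbelian p c := by
  refine Hypermap.isElementaryAbelian_of_hom (Hypermap.regHypermap_isCubic _)
    (Hypermap.regHypermap_isOrientablyRegular _) _ hc (fun a => ?_) ?_ (quotientClass W)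
    (quotientClass_surjective W) fun m => ?_
  · change Multiplicative.ofAdd (p • a.toAdd) = 1
    rw [← Nat.cast_smul_eq_nsmul (ZMod p), CharP.cast_eq_zero, zero_smul]
    rfl
  · rw [Nat.card_congr Multiplicative.toAdd, Module.natCard_eq_pow_finrank (K := ZMod p), hW,
      Nat.card_zmod]
  · rw [quotientClass_eq_one_iff, ← coe_mem_subgroupOfSubrep, ← MonoidHom.mem_ker,
      Hypermap.ker_monodromy_regHypermap]

variable {W}

/-- Each homomorphism to an elementary abelian `p`-group factors through the homology. -/
lemma exists_submodule_of_hom {A : Type*} [CommGroup A] (hA : ∀ a : A, a ^ p = 1)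
    (f : edgePuncturedPi →* A) :
    ∃ W : Submodule (ZMod p) (Homology (ZMod p)), ∀ m, homologyClass (ZMod p) m ∈ W ↔ f m = 1 := by
  -- An abelian group of exponent dividing p is an F_p-vector space; W is the kernel of the induced
  -- linear map.
  let _ : Module (ZMod p) (Additive A) := AddCommGroup.zmodModule hA
  refine ⟨LinearMap.ker (homologyLift (R := ZMod p) (B := Additive A) f), fun m => ?_⟩
  have hm := homologyLift_homologyClass (R := ZMod p) (B := Additive A) f m
  exact LinearMap.mem_ker.trans ⟨fun h => hm.symm.trans h, fun h => hm.trans h⟩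

/-- The monodromy kernel of an elementary abelian covering comes from a proper stable subspace of
the homology. -/
lemma exists_subrep_of_isElementaryAbelian {H : Hypermap} {φ : Hypermap.Covering H tetrahedron}
    {r : ℕ} (h : φ.IsElementaryAbelian p r) :
    ∃ W : Subrepresentation (homologyRep (ZMod p)), W ≠ ⊤ ∧
      (Hypermap.monodromy h.isCubic).ker = subgroupOfSubrep W := by
  have hH := h.isCubic
  obtain ⟨hr, hreg, -, -, hcomm, hexp, hcard⟩ := h
  obtain ⟨f, hf, hker⟩ := Hypermap.exists_deckHom hH hreg φ
  let _ : CommGroup (φ.deckGroup)ᵐᵒᵖ :=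
    { (inferInstance : Group (φ.deckGroup)ᵐᵒᵖ) with
      mul_comm := fun a b => MulOpposite.unop_injective
        (Subtype.ext (hcomm _ b.unop.2 _ a.unop.2)) }
  obtain ⟨W, hW⟩ := exists_submodule_of_hom (p := p) (A := (φ.deckGroup)ᵐᵒᵖ)
    (fun a => MulOpposite.unop_injective (Subtype.ext (hexp _ a.unop.2))) f
  have hW' : ∀ m : edgePuncturedPi,
      homologyClass (ZMod p) m ∈ W ↔ Hypermap.monodromy hH m = 1 :=
    fun m => (hW m).trans (hker m)
  refine ⟨⟨W, fun g v hv => ?_⟩, fun htop => ?_, ?_⟩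
  · obtain ⟨m, rfl⟩ := homologyClass_surjective v
    obtain ⟨g, rfl⟩ := QuotientGroup.mk_surjective g
    rw [homologyRep_homologyClass, hW', MulAut.conjNormal_apply, map_mul, map_mul,
      (hW' m).mp hv, mul_one, ← map_mul, mul_inv_cancel, map_one]
  · have h1 : W = ⊤ := congrArg Subrepresentation.toSubmodule htop
    have h2 : ∀ σ : φ.deckGroup, σ = 1 := fun σ => by
      obtain ⟨m, hm⟩ := hf (MulOpposite.op σ)
      have h3 : f m = 1 := (hW m).mp (by rw [h1]; trivial)
      exact MulOpposite.op_injective (hm.symm.trans h3)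
    have h4 : Nat.card φ.deckGroup = 1 :=
      Nat.card_eq_one_iff_unique.mpr ⟨⟨fun a b => (h2 a).trans (h2 b).symm⟩, ⟨1⟩⟩
    rw [hcard] at h4
    exact absurd h4 (Nat.one_lt_pow (by omega) (Fact.out : p.Prime).one_lt).ne'
  · ext g
    constructor
    · intro hg
      lift g to edgePuncturedPi using Hypermap.ker_monodromy_le hH φ hg
      exact coe_mem_subgroupOfSubrep.mpr ((hW' g).mpr hg)
    · intro hg
      lift g to edgePuncturedPi using subgroupOfSubrep_le _ hg
      exact (hW' g).mp (coe_mem_subgroupOfSubrep.mp hg)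

end Subspaces

/-! ### The action of the reversal of the orientation on homology -/

section Reversal

/-- The restriction of the reversal to the fundamental group. -/
def reversalPi : edgePuncturedPi →* edgePuncturedPi :=
  (Hypermap.reversalHom.comp edgePuncturedPi.subtype).codRestrict edgePuncturedPi
    fun m => Hypermap.reversalHom_mem m.2

/-- The reversal on homology. -/
noncomputable def homologyReversal (R : Type) [CommRing R] : Homology R →ₗ[R] Homology R :=
  LinearMap.baseChange R (MonoidHom.toAdditive (Abelianization.map reversalPi)).toIntLinearMap

variable {R : Type} [CommRing R]

lemma homologyReversal_homologyClass (m : edgePuncturedPi) :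
    homologyReversal R (homologyClass R m) = homologyClass R (reversalPi m) := rfl

lemma homologyReversal_homologyReversal (h : Homology R) :
    homologyReversal R (homologyReversal R h) = h := by
  have : homologyReversal R ∘ₗ homologyReversal R = LinearMap.id := by
    refine homology_hom_ext fun m => ?_
    rw [LinearMap.comp_apply, homologyReversal_homologyClass, homologyReversal_homologyClass]
    exact congrArg _ (Subtype.ext (Hypermap.reversalHom_reversalHom m))
  exact LinearMap.congr_fun this h

lemma homologyReversal_homologyRep (g : EdgeTriangleGroup) (h : Homology R) :
    homologyReversal R (homologyRep R (g : TetGroup) h) =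
      homologyRep R (Hypermap.reversalHom g : TetGroup) (homologyReversal R h) := by
  have : homologyReversal R ∘ₗ homologyRep R (g : TetGroup) =
      homologyRep R (Hypermap.reversalHom g : TetGroup) ∘ₗ homologyReversal R := by
    refine homology_hom_ext fun m => ?_
    rw [LinearMap.comp_apply, LinearMap.comp_apply, homologyRep_homologyClass,
      homologyReversal_homologyClass, homologyReversal_homologyClass, homologyRep_homologyClass]
    refine congrArg _ (Subtype.ext ?_)
    change Hypermap.reversalHom (g * m * g⁻¹) = _
    rw [map_mul, map_mul, map_inv]
    rfl
  exact LinearMap.congr_fun this h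

/-- The mirror image of a stable subspace. -/
noncomputable def mirrorSubrep (W : Subrepresentation (homologyRep R)) :
    Subrepresentation (homologyRep R) where
  toSubmodule := W.toSubmodule.comap (homologyReversal R)
  apply_mem_toSubmodule g v hv := by
    obtain ⟨g, rfl⟩ := QuotientGroup.mk_surjective g
    rw [Submodule.mem_comap, homologyReversal_homologyRep]
    exact W.apply_mem_toSubmodule _ hv

lemma mem_mirrorSubrep {W : Subrepresentation (homologyRep R)} {v : Homology R} :
    v ∈ (mirrorSubrep W).toSubmodule ↔ homologyReversal R v ∈ W.toSubmodule := Iff.rfl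

lemma mirrorSubrep_mirrorSubrep (W : Subrepresentation (homologyRep R)) :
    mirrorSubrep (mirrorSubrep W) = W := by
  apply Subrepresentation.toSubmodule_injective
  ext v
  rw [mem_mirrorSubrep, mem_mirrorSubrep, homologyReversal_homologyReversal]

lemma finrank_mirrorSubrep (W : Subrepresentation (homologyRep R)) :
    Module.finrank R (mirrorSubrep W).toSubmodule = Module.finrank R W.toSubmodule := by
  let e : Homology R ≃ₗ[R] Homology R := LinearEquiv.ofInvolutive (homologyReversal R)
    homologyReversal_homologyReversal
  exact (e.submoduleMap (mirrorSubrep W).toSubmodule).finrank_eq.trans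
    (congrArg (fun U : Submodule R (Homology R) => Module.finrank R U)
      (Submodule.map_comap_eq_of_surjective e.surjective W.toSubmodule))

lemma subgroupOfSubrep_mirrorSubrep {p : ℕ} [Fact p.Prime]
    (W : Subrepresentation (homologyRep (ZMod p))) :
    subgroupOfSubrep (mirrorSubrep W) = (subgroupOfSubrep W).comap Hypermap.reversalHom := by
  have key : ∀ m : edgePuncturedPi, (m : EdgeTriangleGroup) ∈ subgroupOfSubrep (mirrorSubrep W) ↔
      Hypermap.reversalHom m ∈ subgroupOfSubrep W := fun m => by
    rw [coe_mem_subgroupOfSubrep, mem_mirrorSubrep, homologyReversal_homologyClass,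
      ← coe_mem_subgroupOfSubrep]
    rfl
  ext g
  constructor
  · intro hg
    lift g to edgePuncturedPi using subgroupOfSubrep_le _ hg
    exact (key g).mp hg
  · intro hg
    have hgM : g ∈ edgePuncturedPi := by
      rw [← Hypermap.reversalHom_reversalHom g]
      exact Hypermap.reversalHom_mem (subgroupOfSubrep_le _ hg)
    exact (key ⟨g, hgM⟩).mpr hg

lemma nonempty_iso_mirror {p : ℕ} [Fact p.Prime]
    {W W' : Subrepresentation (homologyRep (ZMod p))} (h : mirrorSubrep W' = W) :
    Nonempty (Hypermap.Iso (Hypermap.regHypermap (subgroupOfSubrep W)).mirror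
      (Hypermap.regHypermap (subgroupOfSubrep W'))) :=
  Hypermap.nonempty_iso_mirror_regHypermap (by rw [← h, subgroupOfSubrep_mirrorSubrep])

end Reversal

namespace Hypermap

/-- The inverse of an isomorphism. -/
def Iso.symm {H K : Hypermap} (f : Iso H K) : Iso K H :=
  { f.toEquiv.symm with
    map_x := fun d => f.toEquiv.symm_apply_eq.mpr
      (((f.map_x _).trans (congrArg K.x (f.toEquiv.apply_symm_apply d))).symm)
    map_y := fun d => f.toEquiv.symm_apply_eq.mpr
      (((f.map_y _).trans (congrArg K.y (f.toEquiv.apply_symm_apply d))).symm) }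

/-- The composition of two isomorphisms. -/
def Iso.trans {H K L : Hypermap} (f : Iso H K) (g : Iso K L) : Iso H L :=
  { f.toEquiv.trans g.toEquiv with
    map_x := fun d => (congrArg g.toFun (f.map_x d)).trans (g.map_x _)
    map_y := fun d => (congrArg g.toFun (f.map_y d)).trans (g.map_y _) }

end Hypermap

/-! ### The lists of coverings -/

section Lists

variable {p : ℕ} [Fact p.Prime] {n : ℕ} {T : Homology (ZMod p) ≃ₗ[ZMod p] (Fin 5 → ZMod p)}
  {ℓ : Fin 5 → Fin n}
  (hT : ∀ g S, ∀ v ∈ blockSum T ℓ S, homologyRep (ZMod p) g v ∈ blockSum T ℓ S)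

/-- A sum of blocks, as a subrepresentation of the homology. -/
def blockSumRep (S : Finset (Fin n)) : Subrepresentation (homologyRep (ZMod p)) :=
  ⟨blockSum T ℓ S, fun g _ hv => hT g S _ hv⟩

/-- The hypermap which corresponds to a sum of blocks. -/
noncomputable def blockHypermap (S : Finset (Fin n)) : Hypermap :=
  Hypermap.regHypermap (subgroupOfSubrep (blockSumRep hT S))

/-- The covering which corresponds to a sum of blocks. -/
noncomputable def blockCovering (S : Finset (Fin n)) :
    Hypermap.Covering (blockHypermap hT S) tetrahedron :=
  subrepCovering (blockSumRep hT S)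

variable (hℓ : Function.Surjective ℓ)
  (hs : HasSimpleBlocks (homologyRep (ZMod p)) T ℓ)

include hℓ in
lemma blockSumRep_injective : Function.Injective (blockSumRep hT) := fun _ _ h =>
  blockSum_injective hℓ (congrArg Subrepresentation.toSubmodule h)

include hℓ in
lemma eq_of_iso_blockHypermap {S S' : Finset (Fin n)}
    (h : Nonempty (Hypermap.Iso (blockHypermap hT S) (blockHypermap hT S'))) : S = S' := by
  obtain ⟨f⟩ := h
  exact blockSumRep_injective hT hℓ
    (subgroupOfSubrep_injective (Hypermap.eq_of_iso_regHypermap f))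

include hs in
lemma exists_eq_blockSumRep (W : Subrepresentation (homologyRep (ZMod p))) :
    ∃ S, W = blockSumRep hT S := by
  obtain ⟨S, hS⟩ := hs.exists_eq_blockSum fun g w hw => W.apply_mem_toSubmodule g hw
  exact ⟨S, Subrepresentation.toSubmodule_injective hS⟩

include hℓ hs in
/-- The proper sums of simple blocks yield a complete list of coverings. -/
lemma isCompleteList_blockCovering {m : ℕ} {S : Fin m → Finset (Fin n)}
    (hinj : Function.Injective S) (hS : ∀ U, U = Finset.univ ∨ ∃ i, S i = U) {c : Fin m → ℕ}
    (hc : ∀ i, 1 ≤ c i ∧ c i + (Finset.univ.filter fun k => ℓ k ∈ S i).card = 5) :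
    tetrahedron.IsCompleteList p c (fun i => blockHypermap hT (S i))
      (fun i => blockCovering hT (S i)) := by
  refine ⟨fun i => ?_, fun i j h => hinj (eq_of_iso_blockHypermap hT hℓ h), fun H ψ r hψ => ?_⟩
  · refine subrepCovering_isElementaryAbelian _ (hc i).1 ?_
    have h1 := Submodule.finrank_quotient_add_finrank (blockSum T ℓ (S i))
    rw [finrank_blockSum, T.finrank_eq, Module.finrank_fin_fun] at h1
    exact Nat.add_right_cancel (h1.trans (hc i).2.symm)
  · obtain ⟨W, hW, hker⟩ := exists_subrep_of_isElementaryAbelian hψ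
    obtain ⟨U, rfl⟩ := exists_eq_blockSumRep hT hs W
    rcases hS U with rfl | ⟨i, rfl⟩
    · refine absurd (Subrepresentation.toSubmodule_injective ?_) hW
      change blockSum T ℓ Finset.univ = ⊤
      rw [eq_top_iff]
      exact fun v _ k hk => absurd (Finset.mem_univ _) hk
    · exact ⟨i, Hypermap.exists_iso_regHypermap hψ.isCubic hψ.2.1 ψ (subgroupOfSubrep_le _) hker⟩

include hs in
-- The mirror image of a stable subspace is stable, so it is again a sum of blocks; only its
-- dimension is then needed to narrow down which one.
lemma exists_mirrorSubrep_blockSumRep (S : Finset (Fin n)) :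
    ∃ S', mirrorSubrep (blockSumRep hT S) = blockSumRep hT S' ∧
      (Finset.univ.filter fun k => ℓ k ∈ S').card = (Finset.univ.filter fun k => ℓ k ∈ S).card := by
  obtain ⟨S', hS'⟩ := exists_eq_blockSumRep hT hs (mirrorSubrep (blockSumRep hT S))
  refine ⟨S', hS', ?_⟩
  rw [← finrank_blockSum T ℓ S, ← finrank_blockSum T ℓ S']
  have h := finrank_mirrorSubrep (blockSumRep hT S)
  rwa [hS'] at h

include hs in
/-- A sum of blocks which is determined by its dimension is its own mirror image. -/
lemma isReflexible_blockHypermap {S : Finset (Fin n)}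
    (h : ∀ S', (Finset.univ.filter fun k => ℓ k ∈ S').card =
      (Finset.univ.filter fun k => ℓ k ∈ S).card → S' = S) :
    (blockHypermap hT S).IsReflexible := by
  obtain ⟨S', hS', hcard⟩ := exists_mirrorSubrep_blockSumRep hT hs S
  rw [h S' hcard] at hS'
  obtain ⟨f⟩ := nonempty_iso_mirror hS'
  exact ⟨f.symm⟩

lemma nonempty_iso_mirror_blockHypermap {S S' : Finset (Fin n)}
    (h : mirrorSubrep (blockSumRep hT S) = blockSumRep hT S') :
    Nonempty (Hypermap.Iso (blockHypermap hT S').mirror (blockHypermap hT S)) :=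
  nonempty_iso_mirror h

include hℓ in
/-- A sum of blocks which differs from its mirror image yields a chiral hypermap. -/
lemma not_isReflexible_blockHypermap {S S' : Finset (Fin n)} (hne : S ≠ S')
    (h : mirrorSubrep (blockSumRep hT S) = blockSumRep hT S') :
    ¬ (blockHypermap hT S').IsReflexible := by
  rintro ⟨f⟩
  obtain ⟨g⟩ := nonempty_iso_mirror_blockHypermap hT h
  exact hne (eq_of_iso_blockHypermap hT hℓ ⟨f.trans g⟩).symm

end Lists

/-! ### Mirror images of the submodules and the final lists -/

section Split

variable {p : ℕ} [Fact p.Prime] {ζ : ZMod p} (hζ : IsPrimitiveRoot ζ 3)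
  {T : Homology (ZMod p) ≃ₗ[ZMod p] (Fin 5 → ZMod p)}

/-- The reversal of the orientation exchanges the two one-dimensional submodules. -/
lemma mirrorSubrep_blockSumRep_zero (h2 : (2 : ZMod p) ≠ 0)
    (hTx : ∀ v, T (homologyRep (ZMod p) (gx : TetGroup) v) = linX (diag_eq hζ) (T v))
    (hTy : ∀ v, T (homologyRep (ZMod p) (gy : TetGroup) v) = linY (ZMod p) (T v)) :
    mirrorSubrep (blockSumRep (stable_blockSum_split hζ hTx hTy) {0}) =
      blockSumRep (stable_blockSum_split hζ hTx hTy) {1} := by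
  obtain ⟨S', hS', hcard⟩ := exists_mirrorSubrep_blockSumRep (stable_blockSum_split hζ hTx hTy)
    (hasSimpleBlocks_split h2 hζ hTx hTy) {0}
  rcases (by decide : ∀ S' : Finset (Fin 3), (Finset.univ.filter fun k => splitBlock k ∈ S').card =
    (Finset.univ.filter fun k => splitBlock k ∈ ({0} : Finset (Fin 3))).card →
    S' = {0} ∨ S' = {1}) S' hcard with rfl | rfl
  -- Reversal conjugates x to x⁻¹, so the image of a ζ-eigenvector is a ζ⁻¹-eigenvector. If that
  -- image stayed in the ζ-eigenline then ζ² = 1, or the image would be 0, contradicting that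
  -- reversal is an involution.
  · exfalso
    set v := T.symm (Pi.single 0 1) with hv
    have hv0 : v ∈ blockSum T splitBlock {0} := symm_single_mem_blockSum.mpr (by decide)
    have hrv : homologyReversal (ZMod p) v ∈ blockSum T splitBlock {0} := by
      have h : v ∈ (blockSumRep (stable_blockSum_split hζ hTx hTy) {0}).toSubmodule := hv0
      rwa [← hS', mem_mirrorSubrep] at h
    have hxv : homologyRep (ZMod p) (gx : TetGroup) v = ζ • v := by
      apply T.injective
      rw [hTx, map_smul, hv, LinearEquiv.apply_symm_apply]
      ext k; fin_cases k <;> simp [linX_apply]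
    have h1 := homologyReversal_homologyRep gx v
    rw [hxv, map_smul, Hypermap.reversalHom_gx] at h1
    have h3 : homologyRep (ZMod p) (gx : TetGroup) (ζ • homologyReversal (ZMod p) v) =
        homologyReversal (ZMod p) v := by
      rw [h1, ← Module.End.mul_apply, ← map_mul, QuotientGroup.mk_inv, mul_inv_cancel, map_one,
        Module.End.one_apply]
    have h4 := congrFun (congrArg T h3) 0
    rw [hTx, map_smul, linX_apply] at h4
    simp only [Matrix.cons_val_zero, Pi.smul_apply, smul_eq_mul, zero_mul, add_zero] at h4
    have h5 : T (homologyReversal (ZMod p) v) 0 = 0 := by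
      by_contra hne
      have h6 : ζ ^ 2 = 1 := by
        refine mul_right_cancel₀ hne ?_
        rw [one_mul]
        linear_combination h4
      have h7 := hζ.pow_eq_one
      rw [pow_succ, h6, one_mul] at h7
      exact hζ.ne_one (by norm_num) h7
    have h8 : homologyReversal (ZMod p) v = 0 := by
      apply T.injective
      ext k
      rw [map_zero, Pi.zero_apply]
      by_cases hk : k = 0
      · rw [hk, h5]
      · exact hrv k ((by decide : ∀ k : Fin 5, k ≠ 0 → splitBlock k ∉ ({0} : Finset (Fin 3))) k hk)
    have h9 := homologyReversal_homologyReversal v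
    rw [h8, map_zero, hv] at h9
    have h10 := congrFun (congrArg T h9) 0
    simp at h10
  · exact hS'

lemma mirrorSubrep_blockSumRep_one (h2 : (2 : ZMod p) ≠ 0)
    (hTx : ∀ v, T (homologyRep (ZMod p) (gx : TetGroup) v) = linX (diag_eq hζ) (T v))
    (hTy : ∀ v, T (homologyRep (ZMod p) (gy : TetGroup) v) = linY (ZMod p) (T v)) :
    mirrorSubrep (blockSumRep (stable_blockSum_split hζ hTx hTy) {1}) =
      blockSumRep (stable_blockSum_split hζ hTx hTy) {0} := by
  rw [← mirrorSubrep_blockSumRep_zero hζ h2 hTx hTy, mirrorSubrep_mirrorSubrep]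

/-- The mirror image contains that of block 0, namely block 1, and has dimension 4; only one sum of
blocks qualifies. -/
lemma mirrorSubrep_blockSumRep_zero_two (h2 : (2 : ZMod p) ≠ 0)
    (hTx : ∀ v, T (homologyRep (ZMod p) (gx : TetGroup) v) = linX (diag_eq hζ) (T v))
    (hTy : ∀ v, T (homologyRep (ZMod p) (gy : TetGroup) v) = linY (ZMod p) (T v)) :
    mirrorSubrep (blockSumRep (stable_blockSum_split hζ hTx hTy) {0, 2}) =
      blockSumRep (stable_blockSum_split hζ hTx hTy) {1, 2} := by
  obtain ⟨S', hS', hcard⟩ := exists_mirrorSubrep_blockSumRep (stable_blockSum_split hζ hTx hTy)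
    (hasSimpleBlocks_split h2 hζ hTx hTy) {0, 2}
  have hle : blockSum T splitBlock {1} ≤ blockSum T splitBlock S' := by
    have h0 : blockSum T splitBlock {0} ≤ blockSum T splitBlock {0, 2} :=
      (blockSum_le_blockSum splitBlock_surjective).mpr (by decide)
    have h1 := congrArg Subrepresentation.toSubmodule (mirrorSubrep_blockSumRep_zero hζ h2 hTx hTy)
    have h3 := congrArg Subrepresentation.toSubmodule hS'
    exact h1.ge.trans ((Submodule.comap_mono h0).trans h3.le)
  have h1S : 1 ∈ S' := (blockSum_le_blockSum splitBlock_surjective).mp hle (by simp)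
  rw [hS', (by decide : ∀ S' : Finset (Fin 3), 1 ∈ S' →
    (Finset.univ.filter fun k => splitBlock k ∈ S').card =
      (Finset.univ.filter fun k => splitBlock k ∈ ({0, 2} : Finset (Fin 3))).card →
    S' = {1, 2}) S' h1S hcard]

lemma mirrorSubrep_blockSumRep_one_two (h2 : (2 : ZMod p) ≠ 0)
    (hTx : ∀ v, T (homologyRep (ZMod p) (gx : TetGroup) v) = linX (diag_eq hζ) (T v))
    (hTy : ∀ v, T (homologyRep (ZMod p) (gy : TetGroup) v) = linY (ZMod p) (T v)) :
    mirrorSubrep (blockSumRep (stable_blockSum_split hζ hTx hTy) {1, 2}) =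
      blockSumRep (stable_blockSum_split hζ hTx hTy) {0, 2} := by
  rw [← mirrorSubrep_blockSumRep_zero_two hζ h2 hTx hTy, mirrorSubrep_mirrorSubrep]

include hζ in
/-- The seven coverings for `p ≡ 1` mod `3`. -/
theorem exists_completeList_split (h2 : (2 : ZMod p) ≠ 0) :
    ∃ (N : Fin 7 → Hypermap) (φ : ∀ i, (N i).Covering tetrahedron),
      tetrahedron.IsCompleteList p ![1, 1, 2, 3, 4, 4, 5] N φ ∧
      (¬ (N 0).IsReflexible ∧ ¬ (N 1).IsReflexible ∧
        Nonempty (Hypermap.Iso (N 0).mirror (N 1))) ∧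
      (¬ (N 4).IsReflexible ∧ ¬ (N 5).IsReflexible ∧
        Nonempty (Hypermap.Iso (N 4).mirror (N 5))) ∧
      (N 2).IsReflexible ∧ (N 3).IsReflexible ∧ (N 6).IsReflexible := by
  obtain ⟨T, hTx, hTy⟩ := exists_coordinates_split h2 hζ
  have hT := stable_blockSum_split hζ hTx hTy
  have hs := hasSimpleBlocks_split h2 hζ hTx hTy
  have hℓ := splitBlock_surjective
  have m0 := mirrorSubrep_blockSumRep_zero hζ h2 hTx hTy
  have m1 := mirrorSubrep_blockSumRep_one hζ h2 hTx hTy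
  have m02 := mirrorSubrep_blockSumRep_zero_two hζ h2 hTx hTy
  have m12 := mirrorSubrep_blockSumRep_one_two hζ h2 hTx hTy
  -- `S i` names the blocks in the subspace W, so the rank is the total dimension of the blocks left
  -- out. The full set is absent: it would give the trivial covering.
  let S : Fin 7 → Finset (Fin 3) := ![{1, 2}, {0, 2}, {2}, {0, 1}, {1}, {0}, ∅]
  refine ⟨fun i => blockHypermap hT (S i), fun i => blockCovering hT (S i),
    isCompleteList_blockCovering hT hℓ hs (by decide) (by decide) (by decide),
    ⟨not_isReflexible_blockHypermap hT hℓ (by decide) m02,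
      not_isReflexible_blockHypermap hT hℓ (by decide) m12,
      nonempty_iso_mirror_blockHypermap hT m02⟩,
    ⟨not_isReflexible_blockHypermap hT hℓ (by decide) m0,
      not_isReflexible_blockHypermap hT hℓ (by decide) m1,
      nonempty_iso_mirror_blockHypermap hT m0⟩,
    -- These three subspaces have dimensions 3, 2 and 0, each of which occurs only once among sums
    -- of blocks of dimensions 1, 1, 3.
    isReflexible_blockHypermap hT hs (by decide), isReflexible_blockHypermap hT hs (by decide),
    isReflexible_blockHypermap hT hs (by decide)⟩

/-- The three coverings for `p ≡ 2` mod `3`. -/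
theorem exists_completeList_nonsplit (h2 : (2 : ZMod p) ≠ 0)
    (hF : ∀ r : ZMod p, r ^ 2 + r + 1 ≠ 0) :
    ∃ (N : Fin 3 → Hypermap) (φ : ∀ i, (N i).Covering tetrahedron),
      tetrahedron.IsCompleteList p ![2, 3, 5] N φ ∧ ∀ i, (N i).IsReflexible := by
  obtain ⟨T, hTx, hTy⟩ := exists_coordinates_companion h2
  have hT := stable_blockSum_nonsplit hTx hTy
  have hs := hasSimpleBlocks_nonsplit h2 hTx hTy hF
  -- Blocks of dimensions 2 and 3 have sums of pairwise different dimensions, so every hypermap in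
  -- this list is regular.
  let S : Fin 3 → Finset (Fin 2) := ![{1}, {0}, ∅]
  refine ⟨fun i => blockHypermap hT (S i), fun i => blockCovering hT (S i),
    isCompleteList_blockCovering hT nonsplitBlock_surjective hs (by decide) (by decide) (by decide),
    fun i => isReflexible_blockHypermap hT hs ?_⟩
  revert i
  decide

end Split

/-! ### Cube roots of unity modulo `p` -/

lemma two_ne_zero_zmod {p : ℕ} [Fact p.Prime] (hp : p ≠ 2) : (2 : ZMod p) ≠ 0 := by
  intro h
  have h1 : ((2 : ℕ) : ZMod p) = 0 := by exact_mod_cast h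
  rw [ZMod.natCast_eq_zero_iff] at h1
  exact hp ((Nat.prime_dvd_prime_iff_eq Fact.out Nat.prime_two).mp h1)

lemma exists_isPrimitiveRoot_three {p : ℕ} [Fact p.Prime] (hp : p ≡ 1 [MOD 3]) :
    ∃ ζ : ZMod p, IsPrimitiveRoot ζ 3 := by
  have h3 : 3 ∣ Nat.card (ZMod p)ˣ := by
    rw [Nat.card_eq_fintype_card, ZMod.card_units_eq_totient, Nat.totient_prime Fact.out]
    exact (Nat.modEq_iff_dvd' (Fact.out : p.Prime).one_le).mp hp.symm
  obtain ⟨u, hu⟩ := exists_prime_orderOf_dvd_card' 3 h3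
  exact ⟨u, IsPrimitiveRoot.coe_units_iff.mpr (IsPrimitiveRoot.iff_orderOf.mpr hu)⟩

/-- A root satisfies r³ = 1. Since p − 1 ≡ 1 mod 3, Fermat's theorem gives r = r^(p−1) = 1, so 3 = 0
and p = 3, which is excluded. -/
lemma sq_add_self_add_one_ne_zero {p : ℕ} [Fact p.Prime] (hp : p ≡ 2 [MOD 3]) (r : ZMod p) :
    r ^ 2 + r + 1 ≠ 0 := by
  intro h
  have h3 : r ^ 3 = 1 := by linear_combination (r - 1) * h
  have hr0 : r ≠ 0 := by
    rintro rfl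
    simp at h
  have h4 : r ^ (p - 1) = 1 := ZMod.pow_card_sub_one_eq_one hr0
  have hmod : p % 3 = 2 := hp
  have h5 : r = 1 := by
    have h6 : r ^ (p - 1) = r := by
      rw [show p - 1 = 3 * (p / 3) + 1 by omega, pow_succ, pow_mul, h3, one_pow, one_mul]
    rw [← h6, h4]
  rw [h5] at h
  have h7 : ((3 : ℕ) : ZMod p) = 0 := by
    push_cast
    linear_combination h
  rw [ZMod.natCast_eq_zero_iff, Nat.prime_dvd_prime_iff_eq Fact.out Nat.prime_three] at h7
  omega

end PlatonicCoverings

open PlatonicCoverings in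
theorem mainTheorem3 :
    -- the group `G` of the tetrahedron is `A₄`
    edgePuncturedPi = tetMonodromy.ker ∧
    Nonempty (TetGroup ≃* A4) ∧
    -- the homology character
    Module.finrank ℂ (Homology ℂ) = 5 ∧
    (∀ (e : TetGroup ≃* A4) (g : TetGroup), (homologyRep ℂ).character g =
      chi2 (Complex.exp (2 * Real.pi * Complex.I / 3)) (e g) +
      chi3 (Complex.exp (2 * Real.pi * Complex.I / 3)) (e g) + chi4 ℂ (e g)) ∧
    -- type and genus of the coverings
    (∀ p : ℕ, p.Prime → ∀ (H : Hypermap) (φ : H.Covering tetrahedron) (c : ℕ),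
      φ.IsElementaryAbelian p c →
        H.HasType 3 (2 * p) 3 ∧ H.HasGenus (2 * (p : ℤ) ^ c - 3 * (p : ℤ) ^ (c - 1) + 1)) ∧
    -- the case `p ≡ 1` mod `3`: homology mod `p`, and the coverings
    (∀ (p : ℕ) [Fact p.Prime], p ≡ 1 [MOD 3] →
      (∀ e : TetGroup ≃* A4, ∃ (ω : ZMod p)
        (A : Fin 3 → Subrepresentation (homologyRep (ZMod p))),
        IsPrimitiveRoot ω 3 ∧
        DirectSum.IsInternal (fun i => (A i).toSubmodule) ∧
        (∀ i, (A i).toRepresentation.IsIrreducible) ∧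
        (∀ i, Module.finrank (ZMod p) (A i).toSubmodule = ![1, 1, 3] i) ∧
        (∀ g, (A 0).toRepresentation.character g = chi2 ω (e g)) ∧
        (∀ g, (A 1).toRepresentation.character g = chi3 ω (e g)) ∧
        (∀ g, (A 2).toRepresentation.character g = chi4 (ZMod p) (e g))) ∧
      ∃ (N : Fin 7 → Hypermap) (φ : ∀ i, (N i).Covering tetrahedron),
        tetrahedron.IsCompleteList p ![1, 1, 2, 3, 4, 4, 5] N φ ∧
        -- chiral pairs: `c = 1` and `c = 4`
        (¬ (N 0).IsReflexible ∧ ¬ (N 1).IsReflexible ∧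
          Nonempty (Hypermap.Iso (N 0).mirror (N 1))) ∧
        (¬ (N 4).IsReflexible ∧ ¬ (N 5).IsReflexible ∧
          Nonempty (Hypermap.Iso (N 4).mirror (N 5))) ∧
        -- regular: `c = 2, 3, 5`
        (N 2).IsReflexible ∧ (N 3).IsReflexible ∧ (N 6).IsReflexible) ∧
    -- the case `2 < p ≡ 2` mod `3`: homology mod `p`, and the coverings
    (∀ (p : ℕ) [Fact p.Prime], 2 < p → p ≡ 2 [MOD 3] →
      (∀ e : TetGroup ≃* A4, ∃ A : Fin 2 → Subrepresentation (homologyRep (ZMod p)),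
        DirectSum.IsInternal (fun i => (A i).toSubmodule) ∧
        (∀ i, (A i).toRepresentation.IsIrreducible) ∧
        (∀ i, Module.finrank (ZMod p) (A i).toSubmodule = ![2, 3] i) ∧
        (∀ ω : AlgebraicClosure (ZMod p), IsPrimitiveRoot ω 3 →
          ∀ g, algebraMap (ZMod p) (AlgebraicClosure (ZMod p))
            ((A 0).toRepresentation.character g) =
            chi2 ω (e g) + chi3 ω (e g)) ∧
        (∀ g, (A 1).toRepresentation.character g = chi4 (ZMod p) (e g))) ∧
      ∃ (N : Fin 3 → Hypermap) (φ : ∀ i, (N i).Covering tetrahedron),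
        tetrahedron.IsCompleteList p ![2, 3, 5] N φ ∧
        ∀ i, (N i).IsReflexible) := by
  refine ⟨ker_tetMonodromy.symm, ⟨tetGroupEquiv⟩, finrank_homology two_ne_zero,
    character_homology two_ne_zero (Complex.isPrimitiveRoot_exp 3 (by norm_num)),
    fun p hp H φ c h => h.hasType_hasGenus hp, fun p _ hp => ?_, fun p _ h2 hp => ?_⟩
  · have h2 : (2 : ZMod p) ≠ 0 := two_ne_zero_zmod (by rintro rfl; exact absurd hp (by decide))
    obtain ⟨ζ, hζ⟩ := exists_isPrimitiveRoot_three hp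
    exact ⟨homology_decomposition_split h2 hζ, exists_completeList_split hζ h2⟩
  · have h2 : (2 : ZMod p) ≠ 0 := two_ne_zero_zmod h2.ne'
    have hF := sq_add_self_add_one_ne_zero hp
    exact ⟨homology_decomposition_nonsplit h2 hF, exists_completeList_nonsplit h2 hF⟩
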